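/- A (left) skew brace $(A,\cdot,\circ)$ is a set $A$ with two group structures, the additive group $(A,\cdot)$ and the multiplicative group $(A,\circ)$, such that $a\circ(b\cdot c)=(a\circ b)\cdot a^{-1}\cdot(a\circ c)$ for all $a,b,c\in A$, where $a^{-1}$ is the inverse in $(A,\cdot)$. Put $\lambda_a(b)=a^{-1}\cdot(a\circ b)$. An ideal of $A$ is a subgroup $I$ of $(A,\cdot)$ with $\lambda_a(I)\subseteq I$ for all $a\in A$ which is normal in both $(A,\cdot)$ and $(A,\circ)$. The skew brace $A$ is simple if $|A|>1$ and its only ideals are $\{1\}$ and $A$. The opposite skew brace $A^{\mathrm{op}}$ is $(A,\cdot^{\mathrm{op}},\circ)$ with $a\cdot^{\mathrm{op}}b=b\cdot a$. Let $p$ and $q$ be primes such that $q$ divides $(p^p-1)/(p-1)$, and let $n=p^pq$. Let $V=\mathbb F_p^p$ with standard basis $e_1,\dots,e_p$, and let $J\in\mathrm{GL}_p(\mathbb F_p)$ be the Jordan matrix with entries $1$ on the diagonal and on the superdiagonal and $0$ elsewhere. For $T\in\mathrm{GL}_p(\mathbb F_p)$ and $v\in V$ write $(T\,|\,v)=\begin{pmatrix}T&v\\0&1\end{pmatrix}\in\mathrm{GL}_{p+1}(\mathbb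 F_p)$. Given $M\in\mathrm{GL}_p(\mathbb F_p)$ of order $q$ with $JMJ^{-1}=M^p$, let $N=\{(M^k\,|\,v): 0\le k\le q-1,\ v\in V\}$, and let $\mathrm{Hol}(N)=N\rtimes\mathrm{Aut}(N)$ act on $N$ by $(\eta,\alpha)\mu=\eta\,\alpha(\mu)$. Writing $\mathrm{conj}(S)$ for conjugation by $S$, set $$X=[(M\,|\,0),\mathrm{conj}(I\,|\,0)],\quad Y_v=[(I\,|\,v),\mathrm{conj}(I\,|\,{-v})]\ (v\in V),\quad Z=[(I\,|\,e_p),\mathrm{conj}(J\,|\,{-e_p})]$$ and $G=\langle X,Y_{e_{p-1}},Z\rangle\le\mathrm{Hol}(N)$. The group $G$ acts regularly on $N$, so for each $\eta\in N$ it contains exactly one element $g_\eta$ with first component $\eta$; let $B=(N,\cdot,\circ)$ be the skew brace in which $\cdot$ is the multiplication of $N$ and $\circ$ is given by $g_{\eta\circ\mu}=g_\eta g_\mu$. **Theorem 6.1.** There is a matrix $M\in\mathrm{GL}_p(\mathbb F_p)$ of order $q$ with $JMJ^{-1}=M^p$, and for every such $M$, every simple skew brace of order $n$ is isomorphic to $B$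 or to $B^{\mathrm{op}}$. -/

import Mathlib

/-! ### Skew braces -/

/-- A (left) skew brace: a set with two group structures. The additive group is written additively
(it need not be commutative) and the multiplicative group (the circle operation) is written
multiplicatively. -/
class SkewBrace (B : Type*) extends AddGroup B, Group B where
  brace_rel : ∀ a b c : B, a * (b + c) = a * b + -a + a * c

namespace SkewBrace

section Ideals

variable {B : Type*} [SkewBrace B]

/-- The map `λ_a(b) = -a + a ∘ b`. -/
def lam (a b : B) : B := -a + a * b

theorem one_eq_zero : (1 : B) = 0 := by
  have h := brace_rel (1 : B) 0 0
  simpa using h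

variable (B) in
/-- A left ideal: a subgroup of the additive group that is stable under all `λ_a`. -/
structure LeftIdeal extends AddSubgroup B where
  lam_mem : ∀ (a : B) {b : B}, b ∈ carrier → lam a b ∈ carrier

/-- A left ideal is also a subgroup of the multiplicative group. -/
def LeftIdeal.toSubgroup (I : LeftIdeal B) : Subgroup B where
  carrier := I.carrier
  mul_mem' {a b} ha hb := by
    have h := I.add_mem' ha (I.lam_mem a hb)
    simpa [lam] using h
  one_mem' := by
    rw [one_eq_zero]
    exact I.zero_mem'
  inv_mem' {a} ha := by
    have h := I.neg_mem' (I.lam_mem a⁻¹ ha)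
    simpa [lam, one_eq_zero] using h

/-- An ideal: a left ideal that is normal in both groups. -/
def LeftIdeal.IsIdeal (I : LeftIdeal B) : Prop :=
  I.toAddSubgroup.Normal ∧ I.toSubgroup.Normal

variable (B) in
/-- A skew brace is simple if it has more than one element and its only ideals are the trivial
one and the whole skew brace. -/
def IsSimple : Prop :=
  Nontrivial B ∧ ∀ I : LeftIdeal B, I.IsIdeal → I.toAddSubgroup = ⊥ ∨ I.toAddSubgroup = ⊤

end Ideals

/-- The opposite skew brace: on `Bᵃᵒᵖ` the addition is reversed, `op a + op b = op (b + a)`, and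
the multiplication is unchanged, `op a * op b = op (a * b)`. -/
instance {B : Type*} [SkewBrace B] : SkewBrace Bᵃᵒᵖ where
  brace_rel a b c := by
    apply AddOpposite.unop_injective
    simp [brace_rel, add_assoc]

/-- An isomorphism of skew braces is a bijection that preserves both operations; this is
Mathlib's `≃+*`, which only refers to the two operations. -/
def Isomorphic (B C : Type*) [SkewBrace B] [SkewBrace C] : Prop :=
  Nonempty (B ≃+* C)

end SkewBrace

/-! ### The holomorph and its regular subgroups -/

/-- The holomorph `N ⋊ Aut(N)`. -/
abbrev Hol (N : Type*) [Group N] : Type _ := N ⋊[MonoidHom.id (MulAut N)] MulAut N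

namespace Hol

variable {N : Type*} [Group N]

/-- The permutation of `N` given by an element of the holomorph: `(η, α) μ = η α(μ)`. -/
def act (g : Hol N) (μ : N) : N := g.left * g.right μ

/-- A subgroup of the holomorph is regular if it acts simply transitively on `N`. -/
def IsRegular (G : Subgroup (Hol N)) : Prop :=
  ∀ η μ : N, ∃! g : Hol N, g ∈ G ∧ act g η = μ

variable {G : Subgroup (Hol N)}

theorem act_mul (g h : Hol N) (μ : N) : act (g * h) μ = act g (act h μ) := by
  simp [act, mul_assoc]

theorem IsRegular.bijective (hG : IsRegular G) :
    Function.Bijective (fun g : G => (g : Hol N).left) := by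
  constructor
  · intro g h hgh
    obtain ⟨k, -, hk⟩ := hG 1 (g : Hol N).left
    exact Subtype.ext ((hk g ⟨g.2, by simp [act]⟩).trans (hk h ⟨h.2, by simpa [act] using hgh.symm⟩).symm)
  · intro η
    obtain ⟨g, ⟨hg, h⟩, -⟩ := hG 1 η
    exact ⟨⟨g, hg⟩, by simpa [act] using h⟩

/-- For regular `G`, the bijection from `G` to `N` that sends `g_η = (η, α_η)` to `η`. -/
noncomputable def IsRegular.equiv (hG : IsRegular G) : G ≃ N :=
  Equiv.ofBijective _ hG.bijective

/-- The skew brace of a regular subgroup `G` of `Hol(N)`. Its underlying set is `N`. -/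
def Brace (_hG : IsRegular G) : Type _ := N

/-- The additive group of the skew brace of `G` is `N`. -/
instance (hG : IsRegular G) : AddGroup (Brace hG) := inferInstanceAs (AddGroup (Additive N))

/-- The multiplicative group of the skew brace of `G` is defined by `g_{η ∘ μ} = g_η g_μ`. -/
noncomputable instance (hG : IsRegular G) : Group (Brace hG) :=
  (hG.equiv.symm : N ≃ G).group

noncomputable instance (hG : IsRegular G) : SkewBrace (Brace hG) where
  brace_rel := by
    have key : ∀ a b : N, hG.equiv (hG.equiv.symm a * hG.equiv.symm b) =
        a * (hG.equiv.symm a : Hol N).right b := by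
      intro a b
      have h1 : ∀ a : N, (hG.equiv.symm a : Hol N).left = a := fun a =>
        hG.equiv.apply_symm_apply a
      change ((hG.equiv.symm a : Hol N) * (hG.equiv.symm b : Hol N)).left = _
      simp [h1]
    have main : ∀ a b c : N, hG.equiv (hG.equiv.symm a * hG.equiv.symm (b * c)) =
        hG.equiv (hG.equiv.symm a * hG.equiv.symm b) * a⁻¹ *
          hG.equiv (hG.equiv.symm a * hG.equiv.symm c) := by
      intro a b c
      rw [key, key, key]
      simp [mul_assoc]
    exact main

end Hol

/-! ### The groups `N` and `G` -/

namespace PPQ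

open Matrix

section Blocks

variable {p : ℕ}

theorem fromBlocks_mul_aux (A B : Matrix (Fin p) (Fin p) (ZMod p)) (v w : Fin p → ZMod p) :
    fromBlocks A (replicateCol Unit v) 0 1 * fromBlocks B (replicateCol Unit w) 0 1 =
      (fromBlocks (A * B) (replicateCol Unit (v + A *ᵥ w)) 0 1 :
        Matrix (Fin p ⊕ Unit) (Fin p ⊕ Unit) (ZMod p)) := by
  rw [fromBlocks_multiply]
  congr 1
  · simp
  · rw [replicateCol_add, replicateCol_mulVec, Matrix.mul_one, add_comm]
  · simp
  · simp

/-- The invertible block matrix with rows `(A | v)` and `(0 | 1)`. -/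
def block (A : GL (Fin p) (ZMod p)) (v : Fin p → ZMod p) : GL (Fin p ⊕ Unit) (ZMod p) where
  val := fromBlocks A.val (replicateCol Unit v) 0 1
  inv := fromBlocks A⁻¹.val (replicateCol Unit (-(A⁻¹.val *ᵥ v))) 0 1
  val_inv := by
    rw [fromBlocks_mul_aux, ← Units.val_mul, mulVec_neg, mulVec_mulVec, ← Units.val_mul]
    simp
  inv_val := by
    rw [fromBlocks_mul_aux, ← Units.val_mul]
    simp

theorem block_mul (A B : GL (Fin p) (ZMod p)) (v w : Fin p → ZMod p) :
    block A v * block B w = block (A * B) (v + A.val *ᵥ w) :=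
  Units.ext (fromBlocks_mul_aux A.val B.val v w)

theorem block_one : block (1 : GL (Fin p) (ZMod p)) 0 = 1 :=
  Units.ext (by simp [block])

theorem block_inv (A : GL (Fin p) (ZMod p)) (v : Fin p → ZMod p) :
    (block A v)⁻¹ = block A⁻¹ (-(A⁻¹.val *ᵥ v)) :=
  Units.ext rfl

theorem block_inj {A B : GL (Fin p) (ZMod p)} {v w : Fin p → ZMod p}
    (h : block A v = block B w) : A = B ∧ v = w := by
  have h' : fromBlocks A.val (replicateCol Unit v) 0 1 =
      fromBlocks B.val (replicateCol Unit w) 0 1 := congrArg Units.val h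
  rw [fromBlocks_inj] at h'
  exact ⟨Units.ext h'.1, replicateCol_injective h'.2.1⟩

theorem block_conj (A B : GL (Fin p) (ZMod p)) (v w : Fin p → ZMod p) :
    block A w * block B v * (block A w)⁻¹ =
      block (A * B * A⁻¹) (w + A.val *ᵥ v - (A * B * A⁻¹).val *ᵥ w) := by
  rw [block_inv, block_mul, block_mul]
  congr 1
  simp [mulVec_neg, mulVec_mulVec, sub_eq_add_neg, Matrix.mul_assoc]

/-- The group `N` of all block matrices with rows `(M^k | v)` and `(0 | 1)`. -/
def N (M : GL (Fin p) (ZMod p)) : Subgroup (GL (Fin p ⊕ Unit) (ZMod p)) where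
  carrier := {g | ∃ (k : ℤ) (v : Fin p → ZMod p), g = block (M ^ k) v}
  mul_mem' := by
    rintro _ _ ⟨k, v, rfl⟩ ⟨l, w, rfl⟩
    exact ⟨k + l, _, by rw [block_mul, _root_.zpow_add]⟩
  one_mem' := ⟨0, 0, by rw [zpow_zero, block_one]⟩
  inv_mem' := by
    rintro _ ⟨k, v, rfl⟩
    exact ⟨-k, _, by rw [block_inv, _root_.zpow_neg]⟩

theorem block_mem_N (M : GL (Fin p) (ZMod p)) (k : ℤ) (v : Fin p → ZMod p) :
    block (M ^ k) v ∈ N M := ⟨k, v, rfl⟩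

theorem block_one_mem_N (M : GL (Fin p) (ZMod p)) (v : Fin p → ZMod p) :
    block 1 v ∈ N M := ⟨0, v, by rw [zpow_zero]⟩

end Blocks

variable {p : ℕ} [hp : Fact p.Prime]

theorem block_mem_normalizer {M A : GL (Fin p) (ZMod p)} {s : ℕ}
    (hA : A * M * A⁻¹ = M ^ s) (w : Fin p → ZMod p) :
    block A w ∈ Subgroup.normalizer (N M : Set (GL (Fin p ⊕ Unit) (ZMod p))) := by
  apply Subgroup.mem_normalizer_fintype
  rintro _ ⟨k, v, rfl⟩
  rw [block_conj, ← conj_zpow, hA, ← zpow_natCast, ← _root_.zpow_mul]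
  exact block_mem_N M _ _

/-- The automorphism of `N` given by conjugation by a matrix `S` that normalises `N`. -/
def conj {M : GL (Fin p) (ZMod p)} (S : GL (Fin p ⊕ Unit) (ZMod p))
    (hS : S ∈ Subgroup.normalizer (N M : Set (GL (Fin p ⊕ Unit) (ZMod p)))) : MulAut (N M) :=
  (N M).normalizerMonoidHom ⟨S, hS⟩

theorem conj_apply {M : GL (Fin p) (ZMod p)} (S : GL (Fin p ⊕ Unit) (ZMod p))
    (hS : S ∈ Subgroup.normalizer (N M : Set (GL (Fin p ⊕ Unit) (ZMod p)))) (n : N M) :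
    ((conj S hS n : N M) : GL (Fin p ⊕ Unit) (ZMod p)) = S * n * S⁻¹ := rfl

variable (p) in
/-- The Jordan matrix: ones on the diagonal and on the superdiagonal, zeros elsewhere. -/
def jordan : Matrix (Fin p) (Fin p) (ZMod p) :=
  Matrix.of fun i j => if j = i ∨ (j : ℕ) = i + 1 then 1 else 0

variable (p) in
theorem det_jordan : (jordan p).det = 1 := by
  rw [det_of_isUpperTriangular]
  · simp [jordan]
  · intro i j hij
    have h : (j : ℕ) < i := hij
    simp only [jordan, Matrix.of_apply]
    rw [if_neg]
    rintro (h1 | h1)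
    · rw [h1] at h; exact lt_irrefl _ h
    · omega

variable (p) in
/-- The Jordan matrix as an element of `GL_p(𝔽_p)`. -/
def J : GL (Fin p) (ZMod p) :=
  Matrix.GeneralLinearGroup.mkOfDetNeZero (jordan p) (by rw [det_jordan]; exact one_ne_zero)

variable (p) in
/-- The last basis vector `e_p` of `𝔽_p^p` (index `p - 1` of `Fin p`). -/
def eLast : Fin p → ZMod p := Pi.single ⟨p - 1, Nat.sub_lt hp.out.pos one_pos⟩ 1

variable (p) in
/-- The last but one basis vector `e_{p-1}` of `𝔽_p^p` (index `p - 2` of `Fin p`). -/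
def ePenult : Fin p → ZMod p := Pi.single ⟨p - 2, Nat.sub_lt hp.out.pos two_pos⟩ 1

/-- The condition on the matrix `M`: it has order `q` and `J M J⁻¹ = M ^ p`, where `J` is the
Jordan matrix. -/
structure Admissible (q : ℕ) (M : GL (Fin p) (ZMod p)) : Prop where
  orderOf_eq : orderOf M = q
  conj_eq : J p * M * (J p)⁻¹ = M ^ p

/-- `X = [(M | 0), conj (I | 0)]`. -/
def X (M : GL (Fin p) (ZMod p)) : Hol (N M) :=
  ⟨⟨block M 0, 1, 0, by rw [zpow_one]⟩,
    conj (block 1 0) (block_mem_normalizer (s := 1) (by simp) 0)⟩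

/-- `Y_v = [(I | v), conj (I | -v)]`. -/
def Y (M : GL (Fin p) (ZMod p)) (v : Fin p → ZMod p) : Hol (N M) :=
  ⟨⟨block 1 v, block_one_mem_N M v⟩,
    conj (block 1 (-v)) (block_mem_normalizer (s := 1) (by simp) (-v))⟩

/-- `Z = [(I | e_p), conj (J | -e_p)]`. -/
def Z {q : ℕ} {M : GL (Fin p) (ZMod p)} (hM : Admissible q M) : Hol (N M) :=
  ⟨⟨block 1 (eLast p), block_one_mem_N M (eLast p)⟩,
    conj (block (J p) (-eLast p)) (block_mem_normalizer hM.conj_eq (-eLast p))⟩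

/-- The subgroup `G = ⟨X, Y_{e_{p-1}}, Z⟩` of `Hol(N)`. -/
def G {q : ℕ} {M : GL (Fin p) (ZMod p)} (hM : Admissible q M) : Subgroup (Hol (N M)) :=
  Subgroup.closure {X M, Y M (ePenult p), Z hM}

/-! ### `G` is regular -/

/-- The last coordinate. -/
def kap (v : Fin p → ZMod p) : ZMod p := v ⟨p - 1, Nat.sub_lt hp.out.pos one_pos⟩

theorem kap_add (v w : Fin p → ZMod p) : kap (v + w) = kap v + kap w := rfl

theorem J_mulVec (v : Fin p → ZMod p) (i : Fin p) :
    ((J p).val *ᵥ v) i = v i + if h : (i : ℕ) + 1 < p then v ⟨i + 1, h⟩ else 0 := by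
  have hJ : (J p).val = jordan p := rfl
  rw [hJ, mulVec, dotProduct]
  have h1 : ∀ j : Fin p, jordan p i j * v j =
      (if j = i then v j else 0) + (if (j : ℕ) = i + 1 then v j else 0) := by
    intro j
    by_cases hj : j = i
    · subst hj; simp [jordan]
    · simp [jordan, hj]
  rw [Finset.sum_congr rfl (fun j _ => h1 j), Finset.sum_add_distrib]
  congr 1
  · simp
  · split_ifs with h
    · rw [Finset.sum_eq_single ⟨i + 1, h⟩]
      · simp
      · intro j _ hj
        rw [if_neg]
        intro h2
        exact hj (Fin.ext h2)
      · simp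
    · apply Finset.sum_eq_zero
      intro j _
      rw [if_neg]
      intro h2
      have := j.2
      omega

theorem kap_J (v : Fin p → ZMod p) : kap ((J p).val *ᵥ v) = kap v := by
  have := hp.out.pos
  rw [kap, J_mulVec, dif_neg (by simp only; omega), add_zero, kap]

theorem kap_J_pow (k : ℕ) (v : Fin p → ZMod p) : kap ((J p ^ k).val *ᵥ v) = kap v := by
  induction k with
  | zero => simp
  | succ k ih => rw [pow_succ', Units.val_mul, ← mulVec_mulVec, kap_J, ih]

variable (p) in
theorem J_pow_p : J p ^ p = 1 := by
  have hN : ∀ (k : ℕ) (v : Fin p → ZMod p) (i : Fin p), p ≤ i + k →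
      (((jordan p - 1) ^ k) *ᵥ v) i = 0 := by
    intro k
    induction k with
    | zero => intro v i h; have := i.2; omega
    | succ k ih =>
      intro v i h
      rw [pow_succ', ← mulVec_mulVec, sub_mulVec, one_mulVec, Pi.sub_apply]
      have := J_mulVec (((jordan p - 1) ^ k) *ᵥ v) i
      rw [show jordan p = (J p).val from rfl] at *
      rw [this]
      split_ifs with h2
      · rw [ih v ⟨i + 1, h2⟩ (by simp only; omega)]; ring
      · ring
  apply Units.ext
  have h1 : (J p).val = 1 + (jordan p - 1) := by
    rw [show (J p).val = jordan p from rfl]; abel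
  rw [Units.val_pow_eq_pow_val, h1, add_pow_char_of_commute (p := p) (Commute.one_left _), one_pow]
  have h2 : (jordan p - 1) ^ p = 0 := by
    apply Matrix.ext_of_mulVec_single
    intro j
    ext i
    rw [hN p _ i (by omega)]
    simp
  rw [h2, add_zero, Units.val_one]

section Regular

variable {q : ℕ} {M : GL (Fin p) (ZMod p)}

/-- The shape of the elements of `G`. -/
def Shape (g : Hol (N M)) : Prop :=
  ∃ (i : ℤ) (k : ℕ) (v : Fin p → ZMod p), (k : ZMod p) = kap v ∧
    (g.left : GL (Fin p ⊕ Unit) (ZMod p)) = block (M ^ i) ((M ^ i).val *ᵥ v) ∧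
    ∀ n : N M, ((g.right n : N M) : GL (Fin p ⊕ Unit) (ZMod p)) =
      block (J p ^ k) (-v) * n * (block (J p ^ k) (-v))⁻¹

theorem J_pow_conj (hM : Admissible q M) (k : ℕ) (i : ℤ) :
    ∃ j : ℤ, J p ^ k * M ^ i * (J p ^ k)⁻¹ = M ^ j := by
  induction k generalizing i with
  | zero => exact ⟨i, by simp⟩
  | succ k ih =>
    obtain ⟨j, hj⟩ := ih (p * i)
    refine ⟨j, ?_⟩
    rw [← hj, pow_succ, _root_.mul_inv_rev]
    have : J p * M ^ i * (J p)⁻¹ = M ^ ((p : ℤ) * i) := by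
      rw [← conj_zpow, hM.conj_eq, ← zpow_natCast, ← _root_.zpow_mul]
    rw [← this]
    group

theorem shape_mul (hM : Admissible q M) {g h : Hol (N M)} (hg : Shape g) (hh : Shape h) :
    Shape (g * h) := by
  obtain ⟨i, k, v, hk, hl, hr⟩ := hg
  obtain ⟨i', k', v', hk', hl', hr'⟩ := hh
  obtain ⟨j, hj⟩ := J_pow_conj hM k i'
  have hS : block (J p ^ k) (-v) * block (J p ^ k') (-v') =
      block (J p ^ (k + k')) (-(v + (J p ^ k).val *ᵥ v')) := by
    rw [block_mul, pow_add, mulVec_neg, neg_add]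
  refine ⟨i + j, k + k', v + (J p ^ k).val *ᵥ v', ?_, ?_, ?_⟩
  · rw [kap_add, kap_J_pow, Nat.cast_add, hk, hk']
  · have : (g * h).left = g.left * g.right h.left := rfl
    rw [this, Subgroup.coe_mul, hr, hl, hl', block_conj, hj, block_mul, _root_.zpow_add]
    congr 1
    simp only [mulVec_sub, mulVec_add, mulVec_neg, mulVec_mulVec, ← Units.val_mul]
    rw [show J p ^ k * M ^ i' = M ^ j * J p ^ k by rw [← hj]; group]
    simp only [mul_assoc]
    abel
  · intro n
    have : (g * h).right n = g.right (h.right n) := rfl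
    rw [this, hr, hr', ← hS, _root_.mul_inv_rev]
    simp only [mul_assoc]

theorem shape_of_mem (hM : Admissible q M) {g : Hol (N M)} (hg : g ∈ G hM) : Shape g := by
  have hfin : Finite (Hol (N M)) := Finite.of_equiv _ SemidirectProduct.equivProd.symm
  rw [G, ← Subgroup.mem_toSubmonoid, Subgroup.closure_toSubmonoid_of_finite] at hg
  induction hg using Submonoid.closure_induction with
  | one => exact ⟨0, 0, 0, by simp [kap], by simp [block_one], by simp [block_one]⟩
  | mul g h _ _ hg hh => exact shape_mul hM hg hh
  | mem g hg =>
    rcases hg with rfl | rfl | rfl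
    · exact ⟨1, 0, 0, by simp [kap], by simp [X], by intro n; rw [X, conj_apply]; simp⟩
    · refine ⟨0, 0, ePenult p, ?_, by simp [Y], by intro n; rw [Y, conj_apply]; simp⟩
      have := hp.out.two_le
      rw [kap, ePenult, Pi.single_eq_of_ne (by simp [Fin.ext_iff]; omega)]
      simp
    · exact ⟨0, 1, eLast p, by simp [kap, eLast], by simp [Z], by
        intro n; rw [Z, conj_apply]; simp⟩

theorem eq_of_left_eq (hM : Admissible q M) {g h : Hol (N M)} (hg : g ∈ G hM) (hh : h ∈ G hM)
    (hgh : g.left = h.left) : g = h := by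
  obtain ⟨i, k, v, hk, hl, hr⟩ := shape_of_mem hM hg
  obtain ⟨i', k', v', hk', hl', hr'⟩ := shape_of_mem hM hh
  rw [hgh, hl'] at hl
  obtain ⟨h1, h2⟩ := block_inj hl
  have h3 : v' = v := by
    rw [h1] at h2
    have := congrArg (fun w => (M ^ i)⁻¹.val *ᵥ w) h2
    simpa only [mulVec_mulVec, ← Units.val_mul, inv_mul_cancel, Units.val_one, one_mulVec]
      using this
  have h4 : J p ^ k = J p ^ k' := by
    rw [← h3, ← hk'] at hk
    rw [ZMod.natCast_eq_natCast_iff] at hk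
    exact pow_eq_pow_of_modEq hk (J_pow_p p)
  refine SemidirectProduct.ext hgh ?_
  ext1 n
  apply Subtype.ext
  rw [hr, hr', h3, h4]

theorem Y_add (v w : Fin p → ZMod p) : Y M (v + w) = Y M v * Y M w := by
  refine SemidirectProduct.ext ?_ ?_
  · apply Subtype.ext
    change block 1 (v + w) = block 1 v * (block 1 (-v) * block 1 w * (block 1 (-v))⁻¹)
    rw [block_conj, block_mul]
    simp
  · ext1 n
    apply Subtype.ext
    change block 1 (-(v + w)) * (n : GL (Fin p ⊕ Unit) (ZMod p)) * (block 1 (-(v + w)))⁻¹ =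
      block 1 (-v) * (block 1 (-w) * (n : GL (Fin p ⊕ Unit) (ZMod p)) * (block 1 (-w))⁻¹) *
        (block 1 (-v))⁻¹
    have : block 1 (-(v + w)) = block 1 (-v) * block (1 : GL (Fin p) (ZMod p)) (-w) := by
      rw [block_mul]; simp [add_comm]
    simp only [this, _root_.mul_inv_rev, mul_assoc]

theorem Y_zero : Y M 0 = 1 := by
  have h := Y_add (M := M) 0 0
  rw [add_zero] at h
  exact left_eq_mul.mp h

theorem Z_mul_Y (hM : Admissible q M) (v : Fin p → ZMod p) :
    Z hM * Y M v = Y M ((J p).val *ᵥ v) * Z hM := by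
  refine SemidirectProduct.ext ?_ ?_
  · apply Subtype.ext
    change block 1 (eLast p) * (block (J p) (-eLast p) * block 1 v * (block (J p) (-eLast p))⁻¹)
      = block 1 ((J p).val *ᵥ v) * (block 1 (-((J p).val *ᵥ v)) * block 1 (eLast p) *
        (block 1 (-((J p).val *ᵥ v)))⁻¹)
    rw [block_conj, block_conj, block_mul, block_mul]
    simp [add_comm]
  · ext1 n
    apply Subtype.ext
    change block (J p) (-eLast p) * (block 1 (-v) * (n : GL (Fin p ⊕ Unit) (ZMod p)) *
        (block 1 (-v))⁻¹) * (block (J p) (-eLast p))⁻¹ =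
      block 1 (-((J p).val *ᵥ v)) * (block (J p) (-eLast p) *
        (n : GL (Fin p ⊕ Unit) (ZMod p)) * (block (J p) (-eLast p))⁻¹) *
        (block 1 (-((J p).val *ᵥ v)))⁻¹
    have : block (J p) (-eLast p) * block 1 (-v) =
        block 1 (-((J p).val *ᵥ v)) * block (J p) (-eLast p) := by
      rw [block_mul, block_mul]; simp [mulVec_neg, add_comm]
    have h2 := congrArg (fun t => t * (n : GL (Fin p ⊕ Unit) (ZMod p)) * t⁻¹) this
    simpa only [_root_.mul_inv_rev, mul_assoc] using h2

/-- The vectors `v` with `Y_v ∈ G`. -/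
def W (hM : Admissible q M) : AddSubgroup (Fin p → ZMod p) where
  carrier := {v | Y M v ∈ G hM}
  zero_mem' := by rw [Set.mem_ofPred_eq, Y_zero]; exact one_mem _
  add_mem' {a b} ha hb := by rw [Set.mem_ofPred_eq, Y_add]; exact mul_mem ha hb
  neg_mem' {a} ha := by
    have h := Y_add (M := M) a (-a)
    rw [add_neg_cancel, Y_zero] at h
    rw [Set.mem_ofPred_eq, eq_inv_of_mul_eq_one_right h.symm]
    exact inv_mem ha

theorem Z_mem (hM : Admissible q M) : Z hM ∈ G hM := Subgroup.subset_closure (by simp)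

theorem J_mem_W (hM : Admissible q M) {v : Fin p → ZMod p} (hv : v ∈ W hM) :
    (J p).val *ᵥ v ∈ W hM := by
  have h := Z_mul_Y hM v
  change Y M _ ∈ G hM
  rw [← eq_mul_inv_iff_mul_eq] at h
  have h2 : Y M ((J p).val *ᵥ v) = Z hM * Y M v * (Z hM)⁻¹ := by
    rw [Z_mul_Y]; group
  rw [h2]
  exact mul_mem (mul_mem (Z_mem hM) hv) (inv_mem (Z_mem hM))

theorem single_mem_W (hM : Admissible q M) (k : ℕ) (hk : k + 2 ≤ p) :
    (Pi.single ⟨p - 2 - k, by omega⟩ 1 : Fin p → ZMod p) ∈ W hM := by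
  induction k with
  | zero => exact (Subgroup.subset_closure (by simp [ePenult]) : Y M (ePenult p) ∈ G hM)
  | succ k ih =>
    have h1 := ih (by omega)
    have h2 := (W hM).sub_mem (J_mem_W hM h1) h1
    convert h2 using 1
    ext i
    rw [Pi.sub_apply, J_mulVec, add_sub_cancel_left]
    simp only [Pi.single_apply, Fin.ext_iff]
    split_ifs <;> first | rfl | omega

theorem mem_W_of_kap (hM : Admissible q M) {v : Fin p → ZMod p} (hv : kap v = 0) : v ∈ W hM := by
  rw [← Finset.univ_sum_single v]
  apply sum_mem
  intro i _
  have := hp.out.two_le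
  by_cases hi : (i : ℕ) = p - 1
  · have : i = ⟨p - 1, by omega⟩ := Fin.ext hi
    rw [this, show v ⟨p - 1, by omega⟩ = 0 from hv, Pi.single_zero]
    exact zero_mem _
  · have h1 := single_mem_W hM (p - 2 - i) (by omega)
    have h2 : (⟨p - 2 - (p - 2 - i), by omega⟩ : Fin p) = i := Fin.ext (by simp only; omega)
    rw [h2] at h1
    have h3 := (W hM).nsmul_mem h1 (v i).val
    convert h3 using 1
    rw [← Pi.single_smul]
    simp

theorem exists_left (hM : Admissible q M) (v : Fin p → ZMod p) :
    ∃ g ∈ G hM, (g.left : GL (Fin p ⊕ Unit) (ZMod p)) = block 1 v := by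
  have hZ : ∀ k : ℕ, ∃ g ∈ G hM, ∃ t : Fin p → ZMod p, kap t = k ∧
      (g.left : GL (Fin p ⊕ Unit) (ZMod p)) = block 1 t := by
    intro k
    induction k with
    | zero => exact ⟨1, one_mem _, 0, by simp [kap], by simp [block_one]⟩
    | succ k ih =>
      obtain ⟨g, hg, t, ht, hl⟩ := ih
      refine ⟨Z hM * g, mul_mem (Z_mem hM) hg, eLast p + (J p).val *ᵥ t, ?_, ?_⟩
      · rw [kap_add, kap_J, ht]; simp [kap, eLast, add_comm]
      · change block 1 (eLast p) * (block (J p) (-eLast p) * g.left * (block (J p) (-eLast p))⁻¹) = _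
        rw [hl, block_conj, block_mul]
        simp
  obtain ⟨g, hg, t, ht, hl⟩ := hZ (kap v).val
  have hW : v - t ∈ W hM := mem_W_of_kap hM (by
    have : kap (v - t) = kap v - kap t := rfl
    rw [this, ht]; simp)
  refine ⟨Y M (v - t) * g, mul_mem hW hg, ?_⟩
  change block 1 (v - t) * (block 1 (-(v - t)) * g.left * (block 1 (-(v - t)))⁻¹) = _
  rw [hl, block_conj, block_mul]
  simp

theorem X_pow_mul_left (i : ℕ) (g : Hol (N M)) :
    ((X M ^ i * g).left : GL (Fin p ⊕ Unit) (ZMod p)) = block (M ^ i) 0 * g.left := by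
  induction i with
  | zero => simp [block_one]
  | succ i ih =>
    rw [pow_succ', mul_assoc]
    change block M 0 * (block 1 0 * ((X M ^ i * g).left : GL (Fin p ⊕ Unit) (ZMod p)) *
      (block 1 0)⁻¹) = _
    rw [ih, block_one, pow_succ']
    simp only [one_mul, inv_one, mul_one, ← mul_assoc]
    rw [block_mul]
    simp

theorem exists_left' (hM : Admissible q M) (η : N M) : ∃ g ∈ G hM, g.left = η := by
  obtain ⟨_, i, v, rfl⟩ := η
  have hi : ∃ k : ℕ, M ^ k = M ^ i := by
    have h : M ^ i ∈ Submonoid.powers M := mem_powers_iff_mem_zpowers.mpr ⟨i, rfl⟩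
    exact h
  obtain ⟨k, hk⟩ := hi
  obtain ⟨g, hg, hl⟩ := exists_left hM ((M ^ k)⁻¹.val *ᵥ v)
  refine ⟨X M ^ k * g, mul_mem (pow_mem (Subgroup.subset_closure (by simp)) k) hg, ?_⟩
  apply Subtype.ext
  change _ = block (M ^ i) v
  rw [X_pow_mul_left, hl, block_mul, ← hk, mulVec_mulVec, ← Units.val_mul]
  simp

/-- The group `G` is a regular subgroup of `Hol(N)`. -/
theorem isRegular_G (hM : Admissible q M) : Hol.IsRegular (G hM) := by
  intro η μ
  obtain ⟨t, ht, rfl⟩ := exists_left' hM η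
  obtain ⟨s, hs, rfl⟩ := exists_left' hM μ
  have h1 : ∀ g : Hol (N M), Hol.act g t.left = (g * t).left := fun g => rfl
  refine ⟨s * t⁻¹, ⟨mul_mem hs (inv_mem ht), by rw [h1, inv_mul_cancel_right]⟩, ?_⟩
  rintro g ⟨hg, h⟩
  rw [h1] at h
  exact eq_mul_inv_of_mul_eq (eq_of_left_eq hM (mul_mem hg ht) hs h)

end Regular

/-- The skew brace `B` of the regular subgroup `G` of `Hol(N)`. -/
abbrev B {q : ℕ} {M : GL (Fin p) (ZMod p)} (hM : Admissible q M) : Type :=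
  Hol.Brace (isRegular_G hM)

end PPQ

/-!
The order of `p` modulo `q` is `p`, so a `q`-element acting nontrivially on a group `P` of order
`p ^ p` fixes only `1`, leaves no proper nontrivial subgroup invariant, and `P` is elementary
abelian (`commute_and_pow_eq_one`). A group of order `p ^ p * q` has a normal Sylow `q`-subgroup, or it is
`V ⋊ C_q` for such an action (`exists_normal_card`).

Let `A` be a simple skew brace of this order. Characteristic subgroups of the additive group are
left ideals, so the two groups cannot both have a normal Sylow subgroup for the same prime. If the
additive Sylow `q`-subgroup is normal, its additive centralizer leads to a contradiction
(`IsSimple.not_normal_card_q`). So the additive group is `V ⋊ C_q`, and the multiplicative one has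
a normal Sylow `q`-subgroup, generated by some `x`. Additive conjugation by `x` makes `V` a line
over the field with `p ^ p` elements, on which `x` acts as a root of unity `ζ`
(`exists_galoisField_equiv`, `Frame`). Then `λ_x` acts on `V` as a scalar `c`. If `c` is neither
`1` nor `ζ⁻¹`, the elements `a` of `V` for which `-a + x ∘ a` is fixed by `λ_x` form a single
point that is also stable under the transitive action of `V`, which is absurd
(`Frame.act_self_eq`). The case `c = ζ⁻¹` becomes the case `c = 1` in the opposite skew brace.

If `c = 1`, then `λ_x = id`, and everything is determined by the maps `λ_v` with `v` in `V`. They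
act on `V` by semilinear maps. The group `V` under the circle operation is thus a regular group of
semilinear affine maps of the field, and `SemilinearRegular` shows that after a rescaling (Hilbert
90) `λ_v` is the `κ v`-th power of the Frobenius for a nonzero Frobenius-invariant functional `κ`.
This normal form (`NormalFrame`) leaves no choice: Frobenius-invariant functionals are unique up
to scalars, the Frobenius is a Jordan block of size `p`, and so the data agree with `M`, `J` and
the last coordinate (`exists_admissible_coordinates`). The same Jordan basis for the Frobenius
provides an admissible `M`.
-/

/-! ### Arithmetic of the primes `p` and `q` -/

theorem natCast_pow_eq_one_and_ne_one {p q : ℕ} [Fact p.Prime] [Fact q.Prime]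
    (hpq : q ∣ (p ^ p - 1) / (p - 1)) : (p : ZMod q) ^ p = 1 ∧ (p : ZMod q) ≠ 1 := by
  have hp := (Fact.out : p.Prime)
  rw [← Nat.geomSum_eq hp.two_le, ← ZMod.natCast_eq_zero_iff] at hpq
  push_cast at hpq
  refine ⟨?_, fun h => ?_⟩
  · have := mul_geom_sum (p : ZMod q) p
    rw [hpq, mul_zero] at this
    exact (sub_eq_zero.mp this.symm)
  · have h2 := hpq
    rw [h] at h2
    simp only [one_pow, Finset.sum_const, Finset.card_range, nsmul_eq_mul, mul_one, h] at h2
    exact one_ne_zero h2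

/-- The order of `p` modulo `q` is `p`. This is the form in which the divisibility hypothesis is
used throughout. -/
theorem orderOf_natCast_zmod {p q : ℕ} [Fact p.Prime] [Fact q.Prime]
    (hpq : q ∣ (p ^ p - 1) / (p - 1)) : orderOf (p : ZMod q) = p :=
  orderOf_eq_prime (natCast_pow_eq_one_and_ne_one hpq).1 (natCast_pow_eq_one_and_ne_one hpq).2

theorem lt_pow_self_of_dvd {p q : ℕ} [Fact p.Prime] (hpq : q ∣ (p ^ p - 1) / (p - 1)) :
    q < p ^ p := by
  have hp := (Fact.out : p.Prime)
  have h1 : 1 < p ^ p := Nat.one_lt_pow hp.ne_zero hp.one_lt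
  have h2 : 0 < (p ^ p - 1) / (p - 1) := by
    rw [← Nat.geomSum_eq hp.two_le]
    exact Finset.sum_pos (fun i _ => pow_pos hp.pos i) ⟨0, by simp [hp.pos]⟩
  calc q ≤ (p ^ p - 1) / (p - 1) := Nat.le_of_dvd h2 hpq
    _ ≤ p ^ p - 1 := Nat.div_le_self _ _
    _ < p ^ p := by omega

theorem ne_of_orderOf {p q : ℕ} [Fact p.Prime] [Fact q.Prime] (ho : orderOf (p : ZMod q) = p) :
    p ≠ q := by
  rintro rfl
  have hp := (Fact.out : p.Prime)
  have := pow_orderOf_eq_one (p : ZMod p)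
  rw [ho, ZMod.natCast_self, zero_pow hp.ne_zero] at this
  exact zero_ne_one this

theorem coprime_pow_of_orderOf {p q : ℕ} [Fact p.Prime] [Fact q.Prime]
    (ho : orderOf (p : ZMod q) = p) : Nat.Coprime (p ^ p) q :=
  Nat.Coprime.pow_left _ ((Nat.coprime_primes Fact.out Fact.out).mpr (ne_of_orderOf ho))

theorem pow_self_modEq_one {p q : ℕ} (ho : orderOf (p : ZMod q) = p) : p ^ p ≡ 1 [MOD q] := by
  rw [← ZMod.natCast_eq_natCast_iff]
  push_cast
  exact orderOf_dvd_iff_pow_eq_one.mp (by rw [ho])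

/-- The only powers of `p` between `1` and `p ^ p` that are `1` modulo `q` are the two extreme
ones. -/
theorem eq_zero_or_eq_of_pow_modEq_one {p q k : ℕ} [Fact p.Prime]
    (ho : orderOf (p : ZMod q) = p) (hk : k ≤ p) (h : p ^ k ≡ 1 [MOD q]) : k = 0 ∨ k = p := by
  rw [← ZMod.natCast_eq_natCast_iff] at h
  push_cast at h
  have h2 := orderOf_dvd_of_pow_eq_one h
  rw [ho] at h2
  rcases Nat.eq_zero_or_pos k with h3 | h3
  · exact Or.inl h3
  · exact Or.inr (le_antisymm hk (Nat.le_of_dvd h3 h2))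

/-! ### Groups of order `p ^ p` with an automorphism of order `q` -/

section Groups

variable {p q : ℕ} [Fact p.Prime] [Fact q.Prime]

/-- Modulo `q`, an invariant subgroup has as many elements as fixed points. -/
theorem card_modEq_card_fixed {P : Type*} [Group P] [Finite P] (φ : P →* P) (hφ : φ^[q] = id)
    (W : Subgroup P) (hW : ∀ w ∈ W, φ w ∈ W) :
    Nat.card W ≡ Nat.card {w : W // φ w = w} [MOD q] := by
  classical
  have := Fintype.ofFinite P
  let f : Function.End W := fun w => ⟨φ w, hW w w.2⟩
  have hf1 : ∀ (n : ℕ) (w : W), (((f ^ n) w : W) : P) = φ^[n] w := by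
    intro n
    induction n with
    | zero => intro w; rfl
    | succ n ih =>
      intro w
      rw [pow_succ', Function.iterate_succ_apply', ← ih]
      rfl
  have hf : f ^ q ^ 1 = 1 := by
    funext w
    apply Subtype.ext
    rw [pow_one, hf1, hφ]
    rfl
  have h := Equiv.Perm.card_fixedPoints_modEq hf
  rw [← Nat.card_eq_fintype_card, ← Nat.card_eq_fintype_card] at h
  have e : Nat.card (Function.fixedPoints f) = Nat.card {w : W // φ w = w} :=
    Nat.card_congr (Equiv.subtypeEquivRight fun w => Subtype.ext_iff)
  rwa [e] at h

/-- The number of fixed points is a power of `p` that is `1` modulo `q`, so it is `1`. -/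
theorem fixed_eq_one (ho : orderOf (p : ZMod q) = p) {P : Type*} [Group P]
    (hP : Nat.card P = p ^ p) (φ : P →* P) (hφ : φ^[q] = id) (h1 : φ ≠ MonoidHom.id P)
    (g : P) (hg : φ g = g) : g = 1 := by
  have hp := (Fact.out : p.Prime)
  have : Finite P := Nat.finite_of_card_ne_zero (by rw [hP]; exact pow_ne_zero _ hp.ne_zero)
  have h2 := card_modEq_card_fixed φ hφ ⊤ (by simp)
  rw [Subgroup.card_top, hP] at h2
  let E : Subgroup P := φ.eqLocus (MonoidHom.id P)
  have h3 : Nat.card {w : (⊤ : Subgroup P) // φ w = w} = Nat.card E :=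
    Nat.card_congr
      { toFun := fun w => ⟨w.1.1, w.2⟩
        invFun := fun w => ⟨⟨w.1, trivial⟩, w.2⟩
        left_inv := fun _ => rfl
        right_inv := fun _ => rfl }
  obtain ⟨k, hk, hE⟩ := (Nat.dvd_prime_pow hp).mp (hP ▸ Subgroup.card_subgroup_dvd_card E)
  rw [h3, hE] at h2
  rcases eq_zero_or_eq_of_pow_modEq_one ho hk (h2.symm.trans (pow_self_modEq_one ho)) with h | h
  · rw [h, pow_zero, Subgroup.card_eq_one] at hE
    have : g ∈ E := hg
    rwa [hE, Subgroup.mem_bot] at this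
  · rw [h, ← hP, Subgroup.card_eq_iff_eq_top] at hE
    refine absurd (MonoidHom.ext fun g => ?_) h1
    have : g ∈ E := hE ▸ Subgroup.mem_top g
    exact this

/-- An invariant subgroup has one fixed point, so its order is `1` modulo `q`. -/
theorem eq_bot_or_eq_top_of_invariant (ho : orderOf (p : ZMod q) = p) {P : Type*} [Group P]
    (hP : Nat.card P = p ^ p) (φ : P →* P) (hφ : φ^[q] = id) (h1 : φ ≠ MonoidHom.id P)
    (W : Subgroup P) (hW : ∀ w ∈ W, φ w ∈ W) : W = ⊥ ∨ W = ⊤ := by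
  have hp := (Fact.out : p.Prime)
  have : Finite P := Nat.finite_of_card_ne_zero (by rw [hP]; exact pow_ne_zero _ hp.ne_zero)
  have h2 := card_modEq_card_fixed φ hφ W hW
  have h3 : Nat.card {w : W // φ w = w} = 1 := by
    rw [Nat.card_eq_one_iff_exists]
    refine ⟨⟨1, by simp⟩, fun w => ?_⟩
    apply Subtype.ext
    apply Subtype.ext
    exact fixed_eq_one ho hP φ hφ h1 _ w.2
  obtain ⟨k, hk, hE⟩ := (Nat.dvd_prime_pow hp).mp (hP ▸ Subgroup.card_subgroup_dvd_card W)
  rw [h3, hE] at h2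
  rcases eq_zero_or_eq_of_pow_modEq_one ho hk h2 with h | h
  · rw [h, pow_zero, Subgroup.card_eq_one] at hE
    exact Or.inl hE
  · rw [h, ← hP, Subgroup.card_eq_iff_eq_top] at hE
    exact Or.inr hE

/-- The centre and the subgroup of elements of order dividing `p` are invariant and nontrivial. -/
theorem commute_and_pow_eq_one (ho : orderOf (p : ZMod q) = p) {P : Type*} [Group P]
    (hP : Nat.card P = p ^ p) (φ : P →* P) (hφ : φ^[q] = id) (h1 : φ ≠ MonoidHom.id P) :
    (∀ g h : P, g * h = h * g) ∧ ∀ g : P, g ^ p = 1 := by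
  have hp := (Fact.out : p.Prime)
  have hq := (Fact.out : q.Prime)
  have : Finite P := Nat.finite_of_card_ne_zero (by rw [hP]; exact pow_ne_zero _ hp.ne_zero)
  have hnt : Nontrivial P := by
    rw [← Finite.one_lt_card_iff_nontrivial, hP]
    exact Nat.one_lt_pow hp.ne_zero hp.one_lt
  have hsurj : Function.Surjective φ := by
    intro g
    refine ⟨φ^[q - 1] g, ?_⟩
    rw [← Function.iterate_succ_apply' φ, Nat.succ_eq_add_one, Nat.sub_add_cancel hq.one_le, hφ]
    rfl
  have hc : ∀ g h : P, g * h = h * g := by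
    have hcn : Nontrivial (Subgroup.center P) := (IsPGroup.of_card hP).center_nontrivial
    rcases eq_bot_or_eq_top_of_invariant ho hP φ hφ h1 (Subgroup.center P) (by
      intro w hw
      rw [Subgroup.mem_center_iff] at hw ⊢
      intro g
      obtain ⟨g', rfl⟩ := hsurj g
      rw [← map_mul, hw, map_mul]) with h | h
    · rw [h] at hcn
      exact absurd hcn (not_nontrivial _)
    · intro g k
      have : k ∈ Subgroup.center P := h ▸ Subgroup.mem_top k
      exact Subgroup.mem_center_iff.mp this g
  refine ⟨hc, ?_⟩
  let W : Subgroup P :=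
    { carrier := {g | g ^ p = 1}
      one_mem' := one_pow p
      mul_mem' := fun {a b} ha hb => by
        change (a * b) ^ p = 1
        rw [(show Commute a b from hc a b).mul_pow, show a ^ p = 1 from ha,
          show b ^ p = 1 from hb, one_mul]
      inv_mem' := fun {a} ha => by
        change a⁻¹ ^ p = 1
        rw [inv_pow, show a ^ p = 1 from ha, inv_one] }
  rcases eq_bot_or_eq_top_of_invariant ho hP φ hφ h1 W (by
    intro w hw
    change φ w ^ p = 1
    rw [← map_pow, show w ^ p = 1 from hw, map_one]) with h | h
  · obtain ⟨g, hg⟩ := exists_prime_orderOf_dvd_card' (G := P) p (by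
      rw [hP]; exact dvd_pow_self p hp.ne_zero)
    have h2 : g ∈ W := by
      change g ^ p = 1
      rw [← hg, pow_orderOf_eq_one]
    rw [h, Subgroup.mem_bot] at h2
    rw [h2, orderOf_one] at hg
    exact absurd hg.symm hp.one_lt.ne'
  · intro g
    have : g ∈ W := h ▸ Subgroup.mem_top g
    exact this

/-! ### Groups of order `p ^ p * q` -/

@[to_additive]
theorem mem_of_pow_mem_of_coprime {H : Type*} [Group H] {V : Subgroup H} [V.Normal] {y : H}
    {m : ℕ} (hm : Nat.Coprime m V.index) (hy : y ^ m ∈ V) : y ∈ V := by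
  have h2 : y ^ V.index ∈ V := V.pow_index_mem y
  have h3 : ((y : H ⧸ V)) ^ m = 1 := by
    rw [← QuotientGroup.mk_pow, QuotientGroup.eq_one_iff]; exact hy
  have h4 : ((y : H ⧸ V)) ^ V.index = 1 := by
    rw [← QuotientGroup.mk_pow, QuotientGroup.eq_one_iff]; exact h2
  rw [← QuotientGroup.eq_one_iff, ← orderOf_eq_one_iff]
  exact Nat.eq_one_of_dvd_coprimes hm (orderOf_dvd_of_pow_eq_one h3) (orderOf_dvd_of_pow_eq_one h4)

theorem card_sylow_eq (ho : orderOf (p : ZMod q) = p) {H : Type*} [Group H] [Finite H]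
    (hH : Nat.card H = p ^ p * q) (S : Sylow q H) :
    Nat.card S = q ∧ (S : Subgroup H).index = p ^ p := by
  have hq := (Fact.out : q.Prime)
  have hcop := coprime_pow_of_orderOf ho
  have hS : Nat.card S = q := by
    rw [S.card_eq_multiplicity, hH, Nat.factorization_mul_apply_of_coprime hcop,
      Nat.factorization_eq_zero_of_not_dvd, hq.factorization_self, zero_add, pow_one]
    exact (Nat.Prime.coprime_iff_not_dvd hq).mp hcop.symm
  refine ⟨hS, ?_⟩
  have := (S : Subgroup H).card_mul_index
  rw [hH, show Nat.card (S : Subgroup H) = q from hS, mul_comm] at this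
  exact Nat.eq_of_mul_eq_mul_right hq.pos this

/-- Burnside's transfer theorem. -/
theorem exists_normal_of_normalizer_le_centralizer (ho : orderOf (p : ZMod q) = p) {H : Type*}
    [Group H] [Finite H] (hH : Nat.card H = p ^ p * q) (S : Sylow q H)
    (hS : Subgroup.normalizer ((S : Subgroup H) : Set H) ≤
      Subgroup.centralizer ((S : Subgroup H) : Set H)) :
    ∃ V : Subgroup H, V.Normal ∧ Nat.card V = p ^ p ∧ V.index = q := by
  have hcompl := MonoidHom.ker_transferSylow_isComplement' S hS
  refine ⟨(MonoidHom.transferSylow S hS).ker, inferInstance, ?_, ?_⟩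
  · rw [← hcompl.index_eq_card, (card_sylow_eq ho hH S).2]
  · rw [hcompl.symm.index_eq_card]
    exact (card_sylow_eq ho hH S).1

/-- In a group of order `p ^ p * q` either the Sylow `q`-subgroup is normal, or the number of Sylow
`q`-subgroups is `p ^ p`; then these are self-normalizing, and Burnside's transfer theorem gives a
normal Sylow `p`-subgroup, on which the elements outside act without fixed points. -/
theorem exists_normal_card (ho : orderOf (p : ZMod q) = p) {H : Type*} [Group H]
    (hH : Nat.card H = p ^ p * q) :
    (∃ Q : Subgroup H, Q.Normal ∧ Nat.card Q = q) ∨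
    ∃ V : Subgroup H, V.Normal ∧ Nat.card V = p ^ p ∧
      ∀ y ∉ V, ∀ v ∈ V, y * v = v * y → v = 1 := by
  have hp := (Fact.out : p.Prime)
  have hq := (Fact.out : q.Prime)
  have hcop := coprime_pow_of_orderOf ho
  have hfin : Finite H := Nat.finite_of_card_ne_zero (by
    rw [hH]; exact mul_ne_zero (pow_ne_zero _ hp.ne_zero) hq.ne_zero)
  have hS : ∀ S : Sylow q H, Nat.card S = q := fun S => (card_sylow_eq ho hH S).1
  have hidx : ∀ S : Sylow q H, (S : Subgroup H).index = p ^ p := fun S => (card_sylow_eq ho hH S).2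
  obtain ⟨S⟩ : Nonempty (Sylow q H) := inferInstance
  obtain ⟨k, hk, hn⟩ := (Nat.dvd_prime_pow hp).mp (hidx S ▸ S.card_dvd_index)
  have hmod := card_sylow_modEq_one q H
  rw [hn] at hmod
  rcases eq_zero_or_eq_of_pow_modEq_one ho hk hmod with h | h
  · left
    rw [h, pow_zero, S.card_eq_index_normalizer, Subgroup.index_eq_one] at hn
    exact ⟨S, Subgroup.normalizer_eq_top_iff.mp hn, hS S⟩
  · right
    rw [h] at hn
    -- Each Sylow `q`-subgroup has index `p ^ p`, as has its normalizer.
    have hnorm : ∀ S : Sylow q H, Subgroup.normalizer ((S : Subgroup H) : Set H) = S := fun S => by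
      refine (Subgroup.eq_of_le_of_card_ge Subgroup.le_normalizer ?_).symm
      have h1 : p ^ p = (Subgroup.normalizer ((S : Subgroup H) : Set H)).index :=
        hn.symm.trans S.card_eq_index_normalizer
      have h2 := (Subgroup.normalizer ((S : Subgroup H) : Set H)).card_mul_index
      rw [hH, ← h1, mul_comm] at h2
      have h3 := Nat.eq_of_mul_eq_mul_left (pow_pos hp.pos p) h2
      rw [h3, show Nat.card (S : Subgroup H) = q from hS S]
    have hcomm : ∀ S : Sylow q H, Subgroup.normalizer ((S : Subgroup H) : Set H) ≤
        Subgroup.centralizer ((S : Subgroup H) : Set H) := fun S => by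
      rw [hnorm S]
      have : IsCyclic (S : Subgroup H) := isCyclic_of_prime_card (hS S)
      have : IsMulCommutative (S : Subgroup H) := inferInstance
      exact Subgroup.le_centralizer _
    obtain ⟨V, hV, hVcard, hVidx⟩ := exists_normal_of_normalizer_le_centralizer ho hH S (hcomm S)
    refine ⟨V, hV, hVcard, fun y hy v hv hyv => ?_⟩
    -- A suitable power of `y` has order `q`, and `v` lies in the normalizer of its span.
    have hy1 : y ^ (p ^ p) ∉ V := fun h => hy (mem_of_pow_mem_of_coprime (by rwa [hVidx]) h)
    have hy2 : orderOf (y ^ (p ^ p)) = q := by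
      apply orderOf_eq_prime
      · rw [← pow_mul, ← hH, pow_card_eq_one']
      · intro h; rw [h] at hy1; exact hy1 V.one_mem
    let R : Sylow q H := Sylow.ofCard (Subgroup.zpowers (y ^ (p ^ p))) (by
      rw [Nat.card_zpowers, hy2, ← S.card_eq_multiplicity, hS])
    have hvR : v ∈ (R : Subgroup H) := by
      rw [← hnorm R]
      apply Subgroup.centralizer_le_normalizer
      rw [Subgroup.mem_centralizer_iff]
      rintro _ ⟨n, rfl⟩
      exact (((show Commute y v from hyv).pow_left _).zpow_left n)
    have h1 : orderOf v ∣ p ^ p := hVcard ▸ V.orderOf_dvd_natCard hv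
    have h2 : orderOf v ∣ q := hS R ▸ (R : Subgroup H).orderOf_dvd_natCard hvR
    exact orderOf_eq_one_iff.mp (Nat.eq_one_of_dvd_coprimes hcop h1 h2)

theorem exists_addNormal_card (ho : orderOf (p : ZMod q) = p) {A : Type*} [AddGroup A]
    (hA : Nat.card A = p ^ p * q) :
    (∃ Q : AddSubgroup A, Q.Normal ∧ Nat.card Q = q) ∨
    ∃ V : AddSubgroup A, V.Normal ∧ Nat.card V = p ^ p ∧
      ∀ y ∉ V, ∀ v ∈ V, y + v = v + y → v = 0 := by
  rcases exists_normal_card (H := Multiplicative A) ho hA with ⟨Q, hQ, hc⟩ | ⟨V, hV, hc, h⟩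
  · exact Or.inl ⟨Subgroup.toAddSubgroup' Q, ⟨fun n hn g => hQ.conj_mem n hn g⟩, hc⟩
  · exact Or.inr ⟨Subgroup.toAddSubgroup' V, ⟨fun n hn g => hV.conj_mem n hn g⟩, hc, h⟩

theorem exists_addNormal_of_central (ho : orderOf (p : ZMod q) = p) {A : Type*} [AddGroup A]
    (hA : Nat.card A = p ^ p * q) {Q : AddSubgroup A} (hQ : Nat.card Q = q)
    (hc : ∀ a, ∀ b ∈ Q, a + b = b + a) :
    ∃ V : AddSubgroup A, V.Normal ∧ Nat.card V = p ^ p := by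
  have hq := (Fact.out : q.Prime)
  have hA' : Nat.card (Multiplicative A) = p ^ p * q := hA
  have hfin : Finite (Multiplicative A) := Nat.finite_of_card_ne_zero (by
    rw [hA']
    exact mul_ne_zero (pow_ne_zero _ (Fact.out : p.Prime).ne_zero) hq.ne_zero)
  obtain ⟨S₀⟩ : Nonempty (Sylow q (Multiplicative A)) := inferInstance
  let S : Sylow q (Multiplicative A) := Sylow.ofCard (AddSubgroup.toSubgroup Q) (by
    rw [← S₀.card_eq_multiplicity, (card_sylow_eq ho hA' S₀).1]
    exact hQ)
  obtain ⟨V, hV, hVc, -⟩ := exists_normal_of_normalizer_le_centralizer ho hA' S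
    fun a _ => Subgroup.mem_centralizer_iff.mpr fun b hb => (hc a b hb).symm
  exact ⟨Subgroup.toAddSubgroup' V, ⟨fun n hn g => hV.conj_mem n hn g⟩, hVc⟩

end Groups

/-! ### The field with `p ^ p` elements -/

section Fields

variable {p q : ℕ} [Fact p.Prime] [Fact q.Prime]

theorem card_galoisField_self : Nat.card (GaloisField p p) = p ^ p :=
  GaloisField.card p p (Fact.out : p.Prime).ne_zero

theorem galoisField_pow_card (c : GaloisField p p) : c ^ p ^ p = c := by
  have : Fintype (GaloisField p p) := Fintype.ofFinite _
  rw [← card_galoisField_self (p := p), Nat.card_eq_fintype_card]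
  exact FiniteField.pow_card c

theorem addSubgroup_eq_bot_or_eq_top_of_invariant (ho : orderOf (p : ZMod q) = p)
    {P : Type*} [AddGroup P] (hP : Nat.card P = p ^ p) (φ : P →+ P) (hφ : φ^[q] = id)
    (h1 : φ ≠ AddMonoidHom.id P) (W : AddSubgroup P) (hW : ∀ w ∈ W, φ w ∈ W) :
    W = ⊥ ∨ W = ⊤ := by
  have h2 : φ.toMultiplicative ≠ MonoidHom.id (Multiplicative P) := fun h =>
    h1 (AddMonoidHom.ext fun x => congrArg Multiplicative.toAdd
      (DFunLike.congr_fun h (Multiplicative.ofAdd x)))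
  rcases eq_bot_or_eq_top_of_invariant (P := Multiplicative P) ho hP φ.toMultiplicative hφ h2
    (AddSubgroup.toSubgroup W) hW with h | h
  · left
    exact AddSubgroup.toSubgroup.injective (h.trans (by rfl))
  · right
    exact AddSubgroup.toSubgroup.injective (h.trans (by rfl))

theorem iterate_mul_left {R : Type*} [Monoid R] (a : R) (n : ℕ) (x : R) :
    (fun y => a * y)^[n] x = a ^ n * x := by
  rw [mul_left_iterate]

/-- An additive subgroup of the field that contains `1` and is stable under multiplication by a
nontrivial `q`-th root of unity is everything. -/
theorem addSubgroup_eq_top_of_mul_mem (ho : orderOf (p : ZMod q) = p) {ζ : GaloisField p p}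
    (hζ : ζ ^ q = 1) (hζ1 : ζ ≠ 1) (W : AddSubgroup (GaloisField p p)) (h1 : 1 ∈ W)
    (hW : ∀ w ∈ W, ζ * w ∈ W) : W = ⊤ := by
  have h := addSubgroup_eq_bot_or_eq_top_of_invariant ho card_galoisField_self
    (AddMonoidHom.mulLeft ζ) (by
      funext x
      change (fun y => ζ * y)^[q] x = x
      rw [iterate_mul_left, hζ, one_mul]) (fun h => hζ1 (by
        have := DFunLike.congr_fun h 1
        simpa using this)) W hW
  refine h.resolve_left fun h => ?_
  rw [h, AddSubgroup.mem_bot] at h1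
  exact one_ne_zero h1

/-- An additive map that commutes with `ζ` is linear over the field. -/
theorem apply_eq_apply_one_mul (ho : orderOf (p : ZMod q) = p) {ζ : GaloisField p p}
    (hζ : ζ ^ q = 1) (hζ1 : ζ ≠ 1) (g : GaloisField p p →+ GaloisField p p)
    (hg : ∀ y, g (ζ * y) = ζ * g y) (y : GaloisField p p) : g y = g 1 * y := by
  let W : AddSubgroup (GaloisField p p) := g.eqLocus (AddMonoidHom.mulLeft (g 1))
  have h : W = ⊤ := addSubgroup_eq_top_of_mul_mem ho hζ hζ1 W (by
    change g 1 = g 1 * 1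
    rw [mul_one]) (fun w hw => by
    change g (ζ * w) = g 1 * (ζ * w)
    rw [hg, show g w = g 1 * w from hw]
    ring)
  have : y ∈ W := h ▸ AddSubgroup.mem_top y
  exact this

/-- A map that is semilinear for `ζ ↦ ζ ^ s` is semilinear for a field automorphism, hence for a
power of the Frobenius. -/
theorem exists_frobenius_semilinear (ho : orderOf (p : ZMod q) = p) {ζ : GaloisField p p}
    (hζ : ζ ^ q = 1) (hζ1 : ζ ≠ 1) (g : GaloisField p p →+ GaloisField p p) (h1 : g 1 ≠ 0)
    {s : ℕ} (hg : ∀ y, g (ζ * y) = ζ ^ s * g y) :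
    ∃ i : ℕ, ζ ^ s = ζ ^ p ^ i ∧ ∀ c y, g (c * y) = c ^ p ^ i * g y := by
  let W : AddSubgroup (GaloisField p p) :=
    { carrier := {c | ∀ y, g (c * y) * g 1 = g c * g y}
      zero_mem' := fun y => by simp
      add_mem' := fun {a b} ha hb y => by
        rw [add_mul, map_add, map_add, add_mul, add_mul, ha, hb]
      neg_mem' := fun {a} ha y => by
        rw [neg_mul, map_neg, map_neg, neg_mul, neg_mul, ha] }
  have h : W = ⊤ := addSubgroup_eq_top_of_mul_mem ho hζ hζ1 W (fun y => by
    rw [one_mul, mul_comm]) (fun w hw y => by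
    rw [mul_assoc, hg, hg, mul_assoc, hw y, mul_assoc])
  have hmul : ∀ c y, g (c * y) * g 1 = g c * g y := fun c =>
    show c ∈ W from h ▸ AddSubgroup.mem_top c
  let τ : GaloisField p p →+* GaloisField p p :=
    { toFun := fun c => g c / g 1
      map_one' := div_self h1
      map_mul' := fun a b => by
        rw [div_mul_div_comm, ← hmul a b, mul_div_mul_right _ _ h1]
      map_zero' := by simp
      map_add' := fun a b => by rw [map_add, add_div] }
  let τ' : GaloisField p p →ₐ[ZMod p] GaloisField p p :=
    { τ with
      commutes' := fun r => by
        have : τ.comp (algebraMap (ZMod p) (GaloisField p p)) = algebraMap _ _ :=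
          Subsingleton.elim _ _
        exact RingHom.congr_fun this r }
  obtain ⟨i, hi⟩ := (FiniteField.bijective_frobeniusAlgHom_pow (ZMod p) (GaloisField p p)).2 τ'
  have hτ : ∀ c, g c / g 1 = c ^ p ^ (i : ℕ) := fun c => by
    have h2 := DFunLike.congr_fun hi c
    simp only [AlgHom.coe_pow, FiniteField.coe_frobeniusAlgHom, pow_iterate, ZMod.card] at h2
    exact h2.symm
  refine ⟨i, ?_, fun c y => ?_⟩
  · rw [← hτ, eq_div_iff h1]
    have := hg 1
    rw [mul_one] at this
    exact this.symm
  · rw [← hτ, div_mul_eq_mul_div, ← hmul, mul_div_cancel_right₀ _ h1]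

/-- The case of `exists_frobenius_semilinear` with `s = p`, for a map that may be zero. -/
theorem frobenius_semilinear (ho : orderOf (p : ZMod q) = p) {ζ : GaloisField p p}
    (hζ : ζ ^ q = 1) (hζ1 : ζ ≠ 1) (g : GaloisField p p →+ GaloisField p p)
    (hg : ∀ y, g (ζ * y) = ζ ^ p * g y) (c y : GaloisField p p) : g (c * y) = c ^ p * g y := by
  let W : AddSubgroup (GaloisField p p) :=
    { carrier := {c | ∀ y, g (c * y) = c ^ p * g y}
      zero_mem' := fun y => by simp [(Fact.out : p.Prime).ne_zero]
      add_mem' := fun {a b} ha hb y => by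
        rw [add_mul, map_add, ha, hb, add_pow_char, add_mul]
      neg_mem' := fun {a} ha y => by
        have h := map_neg (frobenius (GaloisField p p) p) a
        rw [frobenius_def, frobenius_def] at h
        rw [neg_mul, map_neg, ha, h, neg_mul] }
  have h : W = ⊤ := addSubgroup_eq_top_of_mul_mem ho hζ hζ1 W (fun y => by
    rw [one_mul, one_pow, one_mul]) (fun w hw y => by
    rw [mul_assoc, hg, hw y, mul_pow, mul_assoc])
  exact (show c ∈ W from h ▸ AddSubgroup.mem_top c) y

/-- Hilbert 90 for the Frobenius: a Frobenius-semilinear map of order `p` is the Frobenius in a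
rescaled coordinate. -/
theorem exists_conj_frobenius (ho : orderOf (p : ZMod q) = p) {ζ : GaloisField p p}
    (hζ : ζ ^ q = 1) (hζ1 : ζ ≠ 1) (g : GaloisField p p →+ GaloisField p p)
    (hg : ∀ y, g (ζ * y) = ζ ^ p * g y) (hgp : g^[p] 1 = 1) :
    ∃ d : GaloisField p p, d ≠ 0 ∧ ∀ y, g (d * y) = d * y ^ p := by
  have hp := (Fact.out : p.Prime)
  have hsl := frobenius_semilinear ho hζ hζ1 g hg
  have hiter : ∀ k, g^[k] 1 = g 1 ^ (∑ i ∈ Finset.range k, p ^ i) := by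
    intro k
    induction k with
    | zero => simp
    | succ k ih =>
      have h2 := hsl (g^[k] 1) 1
      rw [mul_one] at h2
      rw [Function.iterate_succ_apply', h2, ih, ← pow_mul, ← pow_succ,
        Finset.sum_range_succ', Finset.sum_mul]
      simp only [pow_succ, pow_zero]
  -- The norm of `g 1` is `1`.
  have hnorm : g 1 ^ (∑ i ∈ Finset.range p, p ^ i) = 1 := by rw [← hiter, hgp]
  have hc0 : g 1 ≠ 0 := by
    intro h
    rw [h, zero_pow] at hnorm
    · exact zero_ne_one hnorm
    · exact (Finset.sum_pos (fun i _ => pow_pos hp.pos i) ⟨0, by simp [hp.pos]⟩).ne'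
  have hcard : (p - 1) * ∑ i ∈ Finset.range p, p ^ i = Nat.card (GaloisField p p)ˣ := by
    rw [Nat.card_units, card_galoisField_self]
    have h := Nat.geomSum_eq hp.two_le p
    rw [h, Nat.mul_div_cancel']
    exact Nat.sub_one_dvd_pow_sub_one p p
  obtain ⟨γ, hγ⟩ := IsCyclic.exists_generator (α := (GaloisField p p)ˣ)
  obtain ⟨n, hn⟩ := mem_powers_iff_mem_zpowers.mpr (hγ (Units.mk0 (g 1) hc0)⁻¹)
  have hγo : orderOf γ = Nat.card (GaloisField p p)ˣ := orderOf_eq_card_of_forall_mem_zpowers hγ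
  have hn1 : γ ^ (n * ∑ i ∈ Finset.range p, p ^ i) = 1 := by
    rw [pow_mul, show γ ^ n = (Units.mk0 (g 1) hc0)⁻¹ from hn]
    apply Units.ext
    simp [hnorm]
  have hdvd := orderOf_dvd_of_pow_eq_one hn1
  rw [hγo, ← hcard] at hdvd
  obtain ⟨k, rfl⟩ := Nat.dvd_of_mul_dvd_mul_right
    (Finset.sum_pos (fun i _ => pow_pos hp.pos i) ⟨0, by simp [hp.pos]⟩) hdvd
  refine ⟨((γ ^ k : (GaloisField p p)ˣ) : GaloisField p p), Units.ne_zero _, fun y => ?_⟩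
  have h3 : ((γ ^ k : (GaloisField p p)ˣ) : GaloisField p p) ^ (p - 1) * g 1 = 1 := by
    have : (γ ^ k) ^ (p - 1) = (Units.mk0 (g 1) hc0)⁻¹ := by
      rw [← pow_mul, mul_comm k]; exact hn
    have h4 := congrArg (fun u : (GaloisField p p)ˣ => (u : GaloisField p p) * g 1) this
    simpa [hc0] using h4
  have h5 := hsl ((γ ^ k : (GaloisField p p)ˣ) * y) 1
  rw [mul_one] at h5
  rw [h5, mul_pow]
  generalize ((γ ^ k : (GaloisField p p)ˣ) : GaloisField p p) = d at *
  calc d ^ p * y ^ p * g 1 = d * y ^ p * (d ^ (p - 1) * g 1) := by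
        have h6 : d ^ p = d ^ (p - 1) * d := by
          rw [← pow_succ, Nat.sub_add_cancel hp.one_le]
        rw [h6]; ring
    _ = d * y ^ p := by rw [h3, mul_one]

theorem exists_galoisField_equiv_of_field {U : Type*} [AddCommGroup U] [Module (ZMod p) U]
    (m : Module.End (ZMod p) U) {K : Type*} [Field K] [Algebra (ZMod p) K]
    (hK : Nat.card K = p ^ p) (x : K) (E : K ≃ₗ[ZMod p] U) (hE : ∀ k, E (x * k) = m (E k)) :
    ∃ (ζ : GaloisField p p) (e : GaloisField p p ≃ₗ[ZMod p] U), ∀ y, e (ζ * y) = m (e y) := by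
  have : Finite K := Nat.finite_of_card_ne_zero (by
    rw [hK]; exact pow_ne_zero _ (Fact.out : p.Prime).ne_zero)
  let ψ := GaloisField.algEquivGaloisField p p hK
  refine ⟨ψ x, ψ.symm.toLinearEquiv.trans E, fun y => ?_⟩
  obtain ⟨k, rfl⟩ := ψ.surjective y
  simp only [← map_mul, LinearEquiv.trans_apply, AlgEquiv.toLinearEquiv_apply,
    AlgEquiv.symm_apply_apply, hE]

theorem exists_galoisField_equiv_of_irreducible {U : Type*} [AddCommGroup U]
    [Module (ZMod p) U] (hU : Nat.card U = p ^ p) (m : Module.End (ZMod p) U)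
    (hirr : ∀ W : Submodule (ZMod p) U, (∀ w ∈ W, m w ∈ W) → W = ⊥ ∨ W = ⊤)
    (hker : ∀ f : Polynomial (ZMod p), Polynomial.aeval m f ≠ 0 →
      ∀ u, Polynomial.aeval m f u = 0 → u = 0)
    {v : U} (hv : v ≠ 0) {I : Ideal (Polynomial (ZMod p))} (hmax : I.IsMaximal)
    (hI : ∀ f, f ∈ I ↔ Polynomial.aeval m f = 0) :
    ∃ (ζ : GaloisField p p) (e : GaloisField p p ≃ₗ[ZMod p] U), ∀ y, e (ζ * y) = m (e y) := by
  let _ : Field (Polynomial (ZMod p) ⧸ I) := Ideal.Quotient.field I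
  obtain ⟨Λ, hΛ⟩ : ∃ Λ : (Polynomial (ZMod p) ⧸ I) →ₗ[ZMod p] U,
      ∀ f : Polynomial (ZMod p), Λ (Ideal.Quotient.mk I f) = Polynomial.aeval m f v :=
    ⟨(LinearMap.applyₗ v).comp (Ideal.Quotient.liftₐ I (Polynomial.aeval m)
      fun a ha => (hI a).mp ha).toLinearMap, fun f => rfl⟩
  have hinj : Function.Injective Λ := by
    rw [injective_iff_map_eq_zero]
    intro k hk
    obtain ⟨f, rfl⟩ := Ideal.Quotient.mk_surjective k
    rw [hΛ] at hk
    by_contra h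
    exact hv (hker f (fun h2 => h (Ideal.Quotient.eq_zero_iff_mem.mpr ((hI f).mpr h2))) v hk)
  have hX : ∀ k, Λ (Ideal.Quotient.mk I Polynomial.X * k) = m (Λ k) := by
    intro k
    obtain ⟨f, rfl⟩ := Ideal.Quotient.mk_surjective k
    rw [← map_mul, hΛ, hΛ, map_mul, Polynomial.aeval_X]
    rfl
  have hsurj : Function.Surjective Λ := by
    rw [← LinearMap.range_eq_top]
    refine (hirr _ ?_).resolve_left fun h => ?_
    · rintro _ ⟨k, rfl⟩
      exact ⟨_, hX k⟩
    · have h2 : Λ (Ideal.Quotient.mk I 1) ∈ LinearMap.range Λ := ⟨_, rfl⟩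
      rw [h, Submodule.mem_bot, hΛ, map_one] at h2
      exact hv h2
  exact exists_galoisField_equiv_of_field m
    (hU ▸ Nat.card_congr (LinearEquiv.ofBijective Λ ⟨hinj, hsurj⟩).toEquiv) _
    (LinearEquiv.ofBijective Λ ⟨hinj, hsurj⟩) hX

/-- An endomorphism of order `q` of a space of dimension `p` over `𝔽_p` is multiplication by an
element of the field with `p ^ p` elements. -/
theorem exists_galoisField_equiv (ho : orderOf (p : ZMod q) = p) {U : Type*} [AddCommGroup U]
    [Module (ZMod p) U] (hU : Nat.card U = p ^ p) (m : Module.End (ZMod p) U) (hm : m ^ q = 1)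
    (hm1 : m ≠ 1) :
    ∃ (ζ : GaloisField p p) (e : GaloisField p p ≃ₗ[ZMod p] U), ∀ y, e (ζ * y) = m (e y) := by
  have hp := (Fact.out : p.Prime)
  have hq := (Fact.out : q.Prime)
  have hfin : Finite U := Nat.finite_of_card_ne_zero (by rw [hU]; exact pow_ne_zero _ hp.ne_zero)
  have hnt : Nontrivial U := by
    rw [← Finite.one_lt_card_iff_nontrivial, hU]
    exact Nat.one_lt_pow hp.ne_zero hp.one_lt
  have hirr : ∀ W : Submodule (ZMod p) U, (∀ w ∈ W, m w ∈ W) → W = ⊥ ∨ W = ⊤ := by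
    intro W hW
    rcases addSubgroup_eq_bot_or_eq_top_of_invariant ho hU m.toAddMonoidHom (by
      have := congrArg (fun f : Module.End (ZMod p) U => (f : U → U)) hm
      rw [Module.End.coe_pow] at this
      exact this) (fun h => hm1 (LinearMap.ext fun x =>
        DFunLike.congr_fun h x)) W.toAddSubgroup hW with h | h
    · left
      exact Submodule.toAddSubgroup_injective h
    · right
      exact Submodule.toAddSubgroup_injective h
  have hcomm : ∀ (f : Polynomial (ZMod p)) (u : U),
      m (Polynomial.aeval m f u) = Polynomial.aeval m f (m u) := fun f u => by
    have h : Polynomial.aeval m (Polynomial.X * f) = Polynomial.aeval m (f * Polynomial.X) := by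
      rw [mul_comm]
    rw [map_mul, map_mul, Polynomial.aeval_X] at h
    exact LinearMap.congr_fun h u
  -- The kernel of a polynomial in `m` is invariant, so it is zero or everything.
  have hker : ∀ f : Polynomial (ZMod p), Polynomial.aeval m f ≠ 0 →
      ∀ u, Polynomial.aeval m f u = 0 → u = 0 := by
    intro f hf u hu
    rcases hirr (LinearMap.ker (Polynomial.aeval m f)) (fun w hw => by
      rw [LinearMap.mem_ker] at hw ⊢
      rw [← hcomm, hw, map_zero]) with h | h
    · have : u ∈ LinearMap.ker (Polynomial.aeval m f) := hu
      rwa [h, Submodule.mem_bot] at this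
    · exact absurd (LinearMap.ker_eq_top.mp h) hf
  let I : Ideal (Polynomial (ZMod p)) := RingHom.ker (Polynomial.aeval m)
  have hI : I.IsPrime := by
    refine ⟨fun h => ?_, fun {f g} hfg => ?_⟩
    · have : (1 : Polynomial (ZMod p)) ∈ I := h ▸ Submodule.mem_top
      have h2 : Polynomial.aeval m (1 : Polynomial (ZMod p)) = 0 := this
      rw [map_one] at h2
      exact one_ne_zero h2
    · by_contra! hcon
      refine hcon.2 (LinearMap.ext fun u => hker f hcon.1 _ ?_)
      have h2 : Polynomial.aeval m (f * g) = 0 := hfg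
      rw [map_mul] at h2
      exact LinearMap.congr_fun h2 u
  have hI0 : I ≠ ⊥ := by
    intro h
    have h2 : (Polynomial.X ^ q - 1 : Polynomial (ZMod p)) ∈ I := by
      change Polynomial.aeval m _ = 0
      simp [hm]
    rw [h, Ideal.mem_bot] at h2
    exact Polynomial.X_pow_sub_C_ne_zero hq.pos (1 : ZMod p) (by simpa using h2)
  obtain ⟨v, hv⟩ := exists_ne (0 : U)
  exact exists_galoisField_equiv_of_irreducible hU m hirr hker hv (IsPrime.to_maximal_ideal hI0)
    fun f => Iff.rfl

end Fields

/-! ### Matrices and the field with `p ^ p` elements -/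

section Matrices

open Matrix

variable {p q : ℕ} [Fact p.Prime] [Fact q.Prime]

/-- The Frobenius of the field with `p ^ p` elements, as a linear map over the prime field. -/
noncomputable def frobeniusEnd (p : ℕ) [Fact p.Prime] : Module.End (ZMod p) (GaloisField p p) :=
  (FiniteField.frobeniusAlgHom (ZMod p) (GaloisField p p)).toLinearMap

theorem frobeniusEnd_apply (y : GaloisField p p) : frobeniusEnd p y = y ^ p := by
  simp [frobeniusEnd, ZMod.card]

theorem minpoly_frobeniusEnd :
    minpoly (ZMod p) (frobeniusEnd p) = (Polynomial.X - 1) ^ p := by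
  rw [frobeniusEnd, FiniteField.minpoly_frobeniusAlgHom,
    GaloisField.finrank p (Fact.out : p.Prime).ne_zero, sub_pow_char, one_pow]

/-- The Frobenius is a single Jordan block, since its minimal polynomial has degree `p`. -/
theorem exists_frobeniusEnd_sub_one_pow_ne :
    (frobeniusEnd p - 1) ^ p = 0 ∧ ∃ y, ((frobeniusEnd p - 1) ^ (p - 1)) y ≠ 0 := by
  have hp := (Fact.out : p.Prime)
  have haev : ∀ k, Polynomial.aeval (frobeniusEnd p) ((Polynomial.X - 1 : Polynomial (ZMod p)) ^ k)
      = (frobeniusEnd p - 1) ^ k := fun k => by simp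
  constructor
  · rw [← haev, ← minpoly_frobeniusEnd, minpoly.aeval]
  · by_contra! h
    have h0 : (frobeniusEnd p - 1) ^ (p - 1) = 0 := LinearMap.ext h
    rw [← haev] at h0
    have h1 := minpoly.dvd _ _ h0
    have hX : (Polynomial.X - 1 : Polynomial (ZMod p)) = Polynomial.X - Polynomial.C 1 := by simp
    rw [minpoly_frobeniusEnd] at h1
    have h2 := Polynomial.natDegree_le_of_dvd h1
      (pow_ne_zero _ (by rw [hX]; exact Polynomial.X_sub_C_ne_zero 1))
    rw [hX, Polynomial.natDegree_pow, Polynomial.natDegree_pow, Polynomial.natDegree_X_sub_C] at h2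
    have := hp.pos
    omega

/-- In a suitable basis of the field with `p ^ p` elements the Frobenius is the Jordan matrix. -/
theorem exists_jordan_basis :
    ∃ b : (Fin p → ZMod p) ≃ₗ[ZMod p] GaloisField p p, ∀ u, b ((PPQ.J p).val *ᵥ u) = b u ^ p := by
  have hp := (Fact.out : p.Prime)
  obtain ⟨hnil, y, hy⟩ := exists_frobeniusEnd_sub_one_pow_ne (p := p)
  set D := frobeniusEnd p - 1 with hD
  have hnil' : ∀ n, p ≤ n → (D ^ n) y = 0 := fun n hn => by
    rw [← Nat.sub_add_cancel hn, pow_add, hnil, mul_zero]; rfl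
  let b : (Fin p → ZMod p) →ₗ[ZMod p] GaloisField p p :=
    ∑ i : Fin p, (LinearMap.proj i).smulRight ((D ^ (p - 1 - i)) y)
  have hb : ∀ u, b u = ∑ i : Fin p, u i • (D ^ (p - 1 - i)) y := fun u => by
    simp [b, LinearMap.sum_apply]
  have hDb : ∀ (n : ℕ) u, (D ^ n) (b u) = ∑ i : Fin p, u i • (D ^ (p - 1 - i + n)) y := by
    intro n u
    rw [hb, map_sum]
    refine Finset.sum_congr rfl fun i _ => ?_
    rw [map_smul, add_comm, pow_add]
    rfl
  have hJ : ∀ u, b ((PPQ.J p).val *ᵥ u) = b u ^ p := by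
    intro u
    have h1 : b u ^ p = b u + D (b u) := by
      rw [← frobeniusEnd_apply, hD]
      simp
    have h2 : b ((PPQ.J p).val *ᵥ u) = b u + ∑ i : Fin p,
        (if h : (i : ℕ) + 1 < p then u ⟨i + 1, h⟩ else 0) • (D ^ (p - 1 - i)) y := by
      rw [hb, hb, ← Finset.sum_add_distrib]
      refine Finset.sum_congr rfl fun i _ => ?_
      rw [PPQ.J_mulVec, add_smul]
    rw [h1, h2]
    congr 1
    have h3 := hDb 1 u
    rw [pow_one] at h3
    rw [h3]
    -- Both sums are sums over `range (p - 1)`, shifted by one.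
    have h4 := Finset.sum_range (n := p)
      (fun i => (if h : i + 1 < p then u ⟨i + 1, h⟩ else 0) • (D ^ (p - 1 - i)) y)
    have h5 := Finset.sum_range (n := p)
      (fun i => (if h : i < p then u ⟨i, h⟩ else 0) • (D ^ (p - 1 - i + 1)) y)
    have h6 : ∑ i : Fin p, u i • (D ^ (p - 1 - (i : ℕ) + 1)) y = ∑ i : Fin p,
        (if h : (i : ℕ) < p then u ⟨i, h⟩ else 0) • (D ^ (p - 1 - (i : ℕ) + 1)) y :=
      Finset.sum_congr rfl fun i _ => by rw [dif_pos i.2]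
    have h7 : Finset.range p = Finset.range (p - 1 + 1) := by rw [Nat.sub_add_cancel hp.one_le]
    rw [h6, ← h4, ← h5, h7, Finset.sum_range_succ, Finset.sum_range_succ', dif_neg (by omega),
      zero_smul, hnil' (p - 1 - 0 + 1) (by omega), smul_zero]
    congr 1
    refine Finset.sum_congr rfl fun i hi => ?_
    rw [Finset.mem_range] at hi
    rw [show p - 1 - (i + 1) + 1 = p - 1 - i by omega]
  have hinj : Function.Injective b := by
    rw [injective_iff_map_eq_zero]
    intro u hu
    by_contra hne
    -- Apply `D ^ i` for the largest index `i` of a nonzero coordinate.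
    have hex : (Finset.univ.filter fun i : Fin p => u i ≠ 0).Nonempty := by
      by_contra h
      rw [Finset.not_nonempty_iff_eq_empty, Finset.filter_eq_empty_iff] at h
      exact hne (funext fun i => not_not.mp (h (Finset.mem_univ i)))
    obtain ⟨i, hi, hmax⟩ := Finset.exists_max_image _ (fun i : Fin p => (i : ℕ)) hex
    have h1 := hDb i u
    rw [hu, map_zero, Finset.sum_eq_single i] at h1
    · rw [show p - 1 - (i : ℕ) + i = p - 1 by have := i.2; omega] at h1
      exact (smul_ne_zero (Finset.mem_filter.mp hi).2 hy) h1.symm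
    · intro j _ hji
      by_cases hj : u j = 0
      · rw [hj, zero_smul]
      · have h2 : (j : ℕ) ≤ i := hmax j (by simp [hj])
        have h3 : (j : ℕ) ≠ i := fun h => hji (Fin.ext h)
        rw [hnil' _ (by have := j.2; omega), smul_zero]
    · simp
  have hbij : Function.Bijective b := by
    refine (Nat.bijective_iff_injective_and_card b).mpr ⟨hinj, ?_⟩
    rw [card_galoisField_self, Nat.card_fun, Nat.card_fin, Nat.card_zmod]
  exact ⟨LinearEquiv.ofBijective b hbij, hJ⟩

theorem gl_ext {A B : GL (Fin p) (ZMod p)} (h : ∀ u, A.val *ᵥ u = B.val *ᵥ u) : A = B :=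
  Units.ext (Matrix.ext_of_mulVec_single fun _ => h _)

/-- Multiplication by a `q`-th root of unity, in a Jordan basis for the Frobenius. -/
theorem exists_admissible (ho : orderOf (p : ZMod q) = p) :
    ∃ M : GL (Fin p) (ZMod p), PPQ.Admissible q M := by
  have hp := (Fact.out : p.Prime)
  have hq := (Fact.out : q.Prime)
  obtain ⟨b, hb⟩ := exists_jordan_basis (p := p)
  obtain ⟨z, hz⟩ : ∃ z : (GaloisField p p)ˣ, orderOf z = q := by
    refine exists_prime_orderOf_dvd_card' q ?_
    rw [Nat.card_units, card_galoisField_self]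
    exact (Nat.modEq_iff_dvd' (Nat.one_le_pow _ _ hp.pos)).mp (pow_self_modEq_one ho).symm
  obtain ⟨M, hM⟩ : ∃ M : GL (Fin p) (ZMod p), ∀ u, M.val *ᵥ u = b.symm (z * b u) := by
    let f : Module.End (ZMod p) (Fin p → ZMod p) :=
      b.symm.toLinearMap ∘ₗ LinearMap.mulLeft (ZMod p) (z : GaloisField p p) ∘ₗ b.toLinearMap
    let f' : Module.End (ZMod p) (Fin p → ZMod p) := b.symm.toLinearMap ∘ₗ
      LinearMap.mulLeft (ZMod p) ((z⁻¹ : (GaloisField p p)ˣ) : GaloisField p p) ∘ₗ b.toLinearMap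
    refine ⟨Matrix.GeneralLinearGroup.toLin.symm ⟨f, f', ?_, ?_⟩, fun u => ?_⟩
    · refine LinearMap.ext fun u => ?_
      simp [f, f']
    · refine LinearMap.ext fun u => ?_
      simp [f, f']
    · change (LinearMap.toMatrix' f) *ᵥ u = _
      rw [LinearMap.toMatrix'_mulVec]
      rfl
  have hpow : ∀ (n : ℕ) u, (M ^ n).val *ᵥ u = b.symm ((z : GaloisField p p) ^ n * b u) := by
    intro n
    induction n with
    | zero => intro u; simp
    | succ n ih =>
      intro u
      rw [pow_succ, Units.val_mul, ← mulVec_mulVec, ih, hM, b.apply_symm_apply, pow_succ, mul_assoc]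
  refine ⟨M, ⟨orderOf_eq_prime (gl_ext fun u => ?_) fun h => ?_, ?_⟩⟩
  · rw [hpow, ← Units.val_pow_eq_pow_val, ← hz, pow_orderOf_eq_one]
    simp
  · have h1 := hM (b.symm 1)
    rw [h, b.apply_symm_apply, mul_one, Units.val_one, one_mulVec, b.symm.injective.eq_iff] at h1
    have h2 : z = 1 := Units.ext h1.symm
    rw [h2, orderOf_one] at hz
    exact hq.one_lt.ne hz
  · rw [mul_inv_eq_iff_eq_mul]
    refine gl_ext fun u => b.injective ?_
    rw [Units.val_mul, Units.val_mul, ← mulVec_mulVec, ← mulVec_mulVec, hb, hM, hpow,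
      b.apply_symm_apply, b.apply_symm_apply, hb, mul_pow]

/-- A linear functional that is invariant under the Jordan matrix is a multiple of the last
coordinate. -/
theorem eq_mul_kap (κ : (Fin p → ZMod p) →+ ZMod p) (hκ : ∀ u, κ ((PPQ.J p).val *ᵥ u) = κ u)
    (u : Fin p → ZMod p) : κ u = κ (PPQ.eLast p) * PPQ.kap u := by
  have hp := (Fact.out : p.Prime)
  have hlin : ∀ (a : ZMod p) v, κ (a • v) = a * κ v := fun a v =>
    map_smul (κ.toZModLinearMap p) a v
  have h0 : ∀ i : Fin p, (i : ℕ) + 1 < p → κ (Pi.single i 1) = 0 := by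
    intro i hi
    have h1 := hκ (Pi.single ⟨i + 1, hi⟩ 1)
    have h2 : (PPQ.J p).val *ᵥ (Pi.single ⟨i + 1, hi⟩ 1 : Fin p → ZMod p) =
        Pi.single ⟨i + 1, hi⟩ 1 + Pi.single i 1 := by
      ext j
      rw [PPQ.J_mulVec, Pi.add_apply]
      congr 1
      simp only [Pi.single_apply, Fin.ext_iff]
      have := j.2
      split_ifs <;> first | rfl | omega
    rw [h2, map_add] at h1
    simpa using h1
  have h3 : ∀ i : Fin p, κ (Pi.single i (u i)) = u i * κ (Pi.single i 1) := fun i => by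
    rw [← hlin, ← Pi.single_smul, smul_eq_mul, mul_one]
  conv_lhs => rw [← Finset.univ_sum_single u, map_sum]
  rw [Finset.sum_eq_single ⟨p - 1, Nat.sub_lt hp.pos one_pos⟩]
  · rw [h3, mul_comm]; rfl
  · intro i _ hi
    have : (i : ℕ) ≠ p - 1 := fun h => hi (Fin.ext h)
    rw [h3, h0 i (by have := i.2; omega), mul_zero]
  · simp

/-- For an admissible `M`, the space `𝔽_p ^ p` is the field with `p ^ p` elements, where `M` is
multiplication by a root of unity, `J` is the Frobenius, and the last coordinate is any prescribed
Frobenius-invariant functional `κ`. -/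
theorem exists_admissible_coordinates (ho : orderOf (p : ZMod q) = p) {M : GL (Fin p) (ZMod p)}
    (hM : PPQ.Admissible q M) :
    ∃ ζ : GaloisField p p, ζ ^ q = 1 ∧ ζ ≠ 1 ∧
      ∀ κ : GaloisField p p →+ ZMod p, (∀ y, κ (y ^ p) = κ y) → (∃ y, κ y ≠ 0) →
        ∃ g : (Fin p → ZMod p) ≃+ GaloisField p p, (∀ u, g (M.val *ᵥ u) = ζ * g u) ∧
          (∀ u, g ((PPQ.J p).val *ᵥ u) = g u ^ p) ∧ ∀ u, κ (g u) = PPQ.kap u := by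
  have hp := (Fact.out : p.Prime)
  have hq := (Fact.out : q.Prime)
  let m : Module.End (ZMod p) (Fin p → ZMod p) := Matrix.toLin' M.val
  have hmap : ∀ u, m u = M.val *ᵥ u := fun u => Matrix.toLin'_apply _ _
  have hm : m ^ q = 1 := by
    rw [← Matrix.toLin'_pow, ← Units.val_pow_eq_pow_val, ← hM.orderOf_eq, pow_orderOf_eq_one,
      Units.val_one, Matrix.toLin'_one]
    rfl
  have hm1 : m ≠ 1 := by
    intro h
    have : M = 1 := gl_ext fun u => by
      rw [← hmap, h]; simp
    have h2 := hM.orderOf_eq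
    rw [this, orderOf_one] at h2
    exact hq.one_lt.ne h2
  obtain ⟨ζ, e, he⟩ := exists_galoisField_equiv ho
    (by rw [Nat.card_fun, Nat.card_fin, Nat.card_zmod]) m hm hm1
  have hepow : ∀ (n : ℕ) y, e (ζ ^ n * y) = (M ^ n).val *ᵥ e y := by
    intro n
    induction n with
    | zero => intro y; simp
    | succ n ih =>
      intro y
      rw [pow_succ, mul_assoc, ih, he, hmap, mulVec_mulVec, pow_succ, Units.val_mul]
  have hζ : ζ ^ q = 1 := by
    have h1 := hepow q 1
    rw [← hM.orderOf_eq, pow_orderOf_eq_one, hM.orderOf_eq, mul_one, Units.val_one,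
      one_mulVec] at h1
    exact e.injective h1
  have hζ1 : ζ ≠ 1 := by
    rintro rfl
    refine hm1 (LinearMap.ext fun u => ?_)
    obtain ⟨y, rfl⟩ := e.surjective u
    rw [← he, one_mul]; rfl
  refine ⟨ζ, hζ, hζ1, fun κ hκ hκ0 => ?_⟩
  let σ : GaloisField p p →+ GaloisField p p :=
    (e.symm.toLinearMap ∘ₗ Matrix.toLin' (PPQ.J p).val ∘ₗ e.toLinearMap).toAddMonoidHom
  have hσ : ∀ y, e (σ y) = (PPQ.J p).val *ᵥ e y := fun y => by
    simp [σ]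
  have hσζ : ∀ y, σ (ζ * y) = ζ ^ p * σ y := fun y => by
    apply e.injective
    rw [hσ, hepow, he, hσ, hmap, mulVec_mulVec, mulVec_mulVec, ← Units.val_mul, ← Units.val_mul]
    rw [← hM.conj_eq]
    group
  have hσiter : ∀ (n : ℕ) y, e (σ^[n] y) = (PPQ.J p ^ n).val *ᵥ e y := by
    intro n
    induction n with
    | zero => intro y; simp
    | succ n ih =>
      intro y
      rw [Function.iterate_succ_apply, ih, hσ, mulVec_mulVec, pow_succ, Units.val_mul]
  obtain ⟨d, hd, hdσ⟩ := exists_conj_frobenius ho hζ hζ1 σ hσζ (by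
    apply e.injective
    rw [hσiter, PPQ.J_pow_p, Units.val_one, one_mulVec])
  -- Rescale by `d`, so that `J` becomes the Frobenius, and then by a scalar to normalize `κ`.
  let g₀ : (Fin p → ZMod p) ≃ₗ[ZMod p] GaloisField p p :=
    e.symm.trans (LinearEquiv.smulOfNeZero (GaloisField p p) (GaloisField p p) d⁻¹
      (inv_ne_zero hd) |>.restrictScalars (ZMod p))
  have hg₀ : ∀ u, g₀ u = d⁻¹ * e.symm u := fun u => rfl
  have hg₀M : ∀ u, g₀ (M.val *ᵥ u) = ζ * g₀ u := fun u => by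
    obtain ⟨y, rfl⟩ := e.surjective u
    rw [← hmap, ← he, hg₀, hg₀, e.symm_apply_apply, e.symm_apply_apply]
    ring
  have hg₀J : ∀ u, g₀ ((PPQ.J p).val *ᵥ u) = g₀ u ^ p := fun u => by
    obtain ⟨y, rfl⟩ := e.surjective u
    obtain ⟨w, rfl⟩ : ∃ w, y = d * w := ⟨d⁻¹ * y, by rw [mul_inv_cancel_left₀ hd]⟩
    rw [← hσ, hdσ, hg₀, hg₀, e.symm_apply_apply, e.symm_apply_apply, inv_mul_cancel_left₀ hd,
      inv_mul_cancel_left₀ hd]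
  have hκ' := eq_mul_kap (κ.comp g₀.toLinearMap.toAddMonoidHom) (fun u => by
    change κ (g₀ _) = κ (g₀ u)
    rw [hg₀J, hκ])
  set c : ZMod p := (κ.comp g₀.toLinearMap.toAddMonoidHom) (PPQ.eLast p) with hc
  replace hκ' : ∀ u, κ (g₀ u) = c * PPQ.kap u := hκ'
  have hc0 : c ≠ 0 := by
    intro h
    obtain ⟨y, hy⟩ := hκ0
    obtain ⟨u, rfl⟩ := g₀.surjective y
    rw [hκ', h, zero_mul] at hy
    exact hy rfl
  have hlin : ∀ (a : ZMod p) y, κ (a • y) = a * κ y := fun a y =>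
    map_smul (κ.toZModLinearMap p) a y
  refine ⟨(g₀.trans (LinearEquiv.smulOfNeZero (ZMod p) (GaloisField p p) c⁻¹
    (inv_ne_zero hc0))).toAddEquiv, fun u => ?_, fun u => ?_, fun u => ?_⟩
  · change c⁻¹ • g₀ _ = ζ * (c⁻¹ • g₀ u)
    rw [hg₀M, mul_smul_comm]
  · change c⁻¹ • g₀ _ = (c⁻¹ • g₀ u) ^ p
    rw [hg₀J, smul_pow, ZMod.pow_card]
  · change κ (c⁻¹ • g₀ u) = _
    rw [hlin, hκ', inv_mul_cancel_left₀ hc0]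

end Matrices

/-! ### Left ideals of skew braces -/

namespace SkewBrace

section Basic

variable {A : Type*} [SkewBrace A]

theorem mul_eq_add_lam (a b : A) : a * b = a + lam a b := by
  rw [lam, add_neg_cancel_left]

theorem lam_add (a b c : A) : lam a (b + c) = lam a b + lam a c := by
  simp only [lam, brace_rel, add_assoc]

theorem lam_one (b : A) : lam 1 b = b := by
  rw [lam, one_mul, one_eq_zero, neg_zero, zero_add]

theorem lam_zero (a : A) : lam a 0 = 0 := by
  rw [lam, ← one_eq_zero, mul_one, one_eq_zero, neg_add_cancel]

theorem lam_neg (a b : A) : lam a (-b) = -lam a b := by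
  rw [eq_neg_iff_add_eq_zero, ← lam_add, neg_add_cancel, lam_zero]

theorem lam_mul (a b c : A) : lam (a * b) c = lam a (lam b c) := by
  rw [show lam b c = -b + b * c from rfl, lam_add, lam_neg, lam, lam, lam, mul_assoc, neg_add_rev,
    neg_neg]
  simp only [add_assoc, add_neg_cancel_left]

theorem lam_nsmul (a b : A) (n : ℕ) : lam a (n • b) = n • lam a b := by
  induction n with
  | zero => rw [zero_nsmul, zero_nsmul, lam_zero]
  | succ n ih => rw [succ_nsmul, succ_nsmul, lam_add, ih]

theorem lam_inv_lam (a b : A) : lam a⁻¹ (lam a b) = b := by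
  rw [← lam_mul, inv_mul_cancel, lam_one]

theorem lam_injective (a : A) : Function.Injective (lam a) := fun b c h => by
  rw [← lam_inv_lam a b, h, lam_inv_lam]

theorem lam_pow (a b : A) (n : ℕ) : lam (a ^ n) b = (lam a)^[n] b := by
  induction n with
  | zero => rw [pow_zero, lam_one]; rfl
  | succ n ih => rw [pow_succ', lam_mul, ih, Function.iterate_succ_apply']

/-- A normal Hall subgroup is characteristic, so it is stable under `λ`. -/
theorem lam_mem_of_card [Finite A] {I : AddSubgroup A} [I.Normal]
    (h : Nat.Coprime (Nat.card I) I.index) (a : A) {b : A} (hb : b ∈ I) : lam a b ∈ I := by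
  refine mem_of_nsmul_mem_of_coprime h ?_
  have h1 : Nat.card I • b = 0 :=
    addOrderOf_dvd_iff_nsmul_eq_zero.mp (I.addOrderOf_dvd_natCard hb)
  rw [← lam_nsmul, h1, lam_zero]
  exact I.zero_mem

/-- A normal Hall subgroup of the additive group is a left ideal, and it is an ideal as soon as the
multiplicative group has a normal subgroup of the same order. -/
theorem IsSimple.false_of_normal_card (hA : IsSimple A) {d m : ℕ} (hdm : Nat.Coprime d m)
    (hd : d ≠ 1) (hm : m ≠ 1) (hcard : Nat.card A = d * m) (h0 : d * m ≠ 0)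
    {I : AddSubgroup A} (hI : I.Normal) (hIc : Nat.card I = d)
    {K : Subgroup A} (hK : K.Normal) (hKc : Nat.card K = d) : False := by
  have hfin : Finite A := Nat.finite_of_card_ne_zero (by rwa [hcard])
  have hd0 : 0 < d := Nat.pos_of_ne_zero (left_ne_zero_of_mul h0)
  have hIi : I.index = m := by
    have := I.card_mul_index
    rw [hIc, hcard] at this
    exact Nat.eq_of_mul_eq_mul_left hd0 this
  have hKi : K.index = m := by
    have := K.card_mul_index
    rw [hKc, hcard] at this
    exact Nat.eq_of_mul_eq_mul_left hd0 this
  let L : LeftIdeal A := ⟨I, fun a b hb => lam_mem_of_card (by rwa [hIc, hIi]) a hb⟩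
  have hLK : L.toSubgroup = K := by
    have hLc : Nat.card L.toSubgroup = d := hIc
    refine Subgroup.eq_of_le_of_card_ge (fun a ha => ?_) (by rw [hKc, hLc])
    refine mem_of_pow_mem_of_coprime (m := d) (by rwa [hKi]) ?_
    rw [orderOf_dvd_iff_pow_eq_one.mp (hLc ▸ L.toSubgroup.orderOf_dvd_natCard ha)]
    exact K.one_mem
  rcases hA.2 L ⟨hI, hLK ▸ hK⟩ with h | h
  · have h2 : I = ⊥ := h
    rw [h2, AddSubgroup.card_bot] at hIc
    exact hd hIc.symm
  · have h2 : I = ⊤ := h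
    rw [h2, AddSubgroup.index_top] at hIi
    exact hm hIi.symm

end Basic

/-! ### The Sylow `q`-subgroup of the additive group is not normal -/

section NotNormal

variable {p q : ℕ} [Fact p.Prime] [Fact q.Prime] {A : Type*} [SkewBrace A]

/-- `λ` acts on a left ideal of prime order `q` through a commutative group of order prime to
`q`, so the action is trivial when the multiplicative group is `V ⋊ C_q` with `q`
acting on `V` without fixed points. -/
theorem lam_eq_self_of_prime [Finite A] {Q : AddSubgroup A} (hQ : Nat.card Q = q)
    (hlam : ∀ a, ∀ b ∈ Q, lam a b ∈ Q) {V : Subgroup A} [V.Normal] (hVi : V.index = q)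
    (hfpf : ∀ y ∉ V, ∀ v ∈ V, y * v = v * y → v = 1) (a : A) {b : A} (hb : b ∈ Q) :
    lam a b = b := by
  have hq := (Fact.out : q.Prime)
  by_cases hb0 : b = 0
  · rw [hb0, lam_zero]
  have hbo : addOrderOf b = q := by
    have h := hQ ▸ Q.addOrderOf_dvd_natCard hb
    exact ((Nat.dvd_prime hq).mp h).resolve_left fun h => hb0 (AddMonoid.addOrderOf_eq_one_iff.mp h)
  have hgen : ∀ c ∈ Q, ∃ k : ℕ, k • b = c := by
    intro c hc
    have h1 : AddSubgroup.zmultiples b = Q := AddSubgroup.eq_of_le_of_card_ge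
      (by rwa [AddSubgroup.zmultiples_le]) (by rw [Nat.card_zmultiples, hbo, hQ])
    rw [← h1, ← mem_multiples_iff_mem_zmultiples] at hc
    exact hc
  choose k hk using fun a => hgen (lam a b) (hlam a b hb)
  have hmod : ∀ m n : ℕ, m • b = n • b ↔ (m : ZMod q) = n := fun m n => by
    rw [nsmul_eq_nsmul_iff_modEq, hbo, ZMod.natCast_eq_natCast_iff]
  let χ : A →* ZMod q :=
    { toFun := fun a => k a
      map_one' := by
        have := hk 1
        rw [lam_one] at this
        nth_rewrite 2 [← one_nsmul b] at this
        rw [hmod, Nat.cast_one] at this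
        exact this
      map_mul' := fun a c => by
        rw [← Nat.cast_mul, ← hmod, hk, lam_mul, ← hk c, lam_nsmul, ← hk a, smul_smul, mul_comm] }
  have hχV : ∀ v ∈ V, χ v = 1 := by
    obtain ⟨y, hy⟩ : ∃ y, y ∉ V := by
      by_contra! h
      have : V = ⊤ := (Subgroup.eq_top_iff' V).mpr h
      rw [this, Subgroup.index_top] at hVi
      exact hq.one_lt.ne hVi
    -- Every element of `V` is a commutator with `y`.
    let f : V → V := fun v => ⟨y * v * y⁻¹ * (v : A)⁻¹,
      V.mul_mem (Subgroup.Normal.conj_mem ‹_› _ v.2 y) (V.inv_mem v.2)⟩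
    have hf : Function.Injective f := by
      intro v w hvw
      have h1 : y * (v : A) * y⁻¹ * (v : A)⁻¹ = y * w * y⁻¹ * (w : A)⁻¹ := congrArg Subtype.val hvw
      have h2 : (w : A)⁻¹ * v = 1 := by
        refine hfpf y hy _ (V.mul_mem (V.inv_mem w.2) v.2) ?_
        simp only [mul_assoc, mul_right_inj] at h1
        have h3 : (v : A) * y * (v : A)⁻¹ = w * y * (w : A)⁻¹ := by
          have := congrArg (fun t => t⁻¹) h1
          simpa only [_root_.mul_inv_rev, inv_inv, mul_assoc] using this
        calc y * ((w : A)⁻¹ * v) = (w : A)⁻¹ * (w * y * (w : A)⁻¹) * v := by group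
          _ = (w : A)⁻¹ * v * y := by rw [← h3]; group
      exact Subtype.ext (inv_mul_eq_one.mp h2).symm
    intro v hv
    obtain ⟨w, hw⟩ := Finite.surjective_of_injective hf ⟨v, hv⟩
    have h1 : y * (w : A) * y⁻¹ * (w : A)⁻¹ = v := congrArg Subtype.val hw
    have h2 : χ y * χ y⁻¹ = 1 := by rw [← map_mul, mul_inv_cancel, map_one]
    have h3 : χ w * χ (w : A)⁻¹ = 1 := by rw [← map_mul, mul_inv_cancel, map_one]
    rw [← h1, map_mul, map_mul, map_mul]
    linear_combination χ w * χ (w : A)⁻¹ * h2 + h3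
  have h1 : χ a = 1 := by
    rw [← ZMod.pow_card (χ a), ← map_pow]
    exact hχV _ (hVi ▸ V.pow_index_mem a)
  rw [← hk a]
  nth_rewrite 2 [← one_nsmul b]
  rw [hmod, Nat.cast_one]
  exact h1

/-- Suppose that the Sylow `q`-subgroup `Q` of the additive group is normal. By simplicity the
multiplicative group is `V ⋊ C_q`, and `λ` is trivial on `Q`. The additive centralizer of `Q` is a
left ideal that meets `V` in an invariant subgroup. If they meet trivially, the additive group acts
on `Q` through at least `p ^ p > q` different automorphisms; otherwise `Q` is central and the
additive Sylow `p`-subgroup is an ideal. -/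
theorem IsSimple.not_normal_card_q (ho : orderOf (p : ZMod q) = p) (hlt : q < p ^ p)
    (hcard : Nat.card A = p ^ p * q) (hA : IsSimple A) {Q : AddSubgroup A} (hQn : Q.Normal)
    (hQ : Nat.card Q = q) : False := by
  have hp := (Fact.out : p.Prime)
  have hq := (Fact.out : q.Prime)
  have hcop := coprime_pow_of_orderOf ho
  have hpp : p ^ p ≠ 1 := (Nat.one_lt_pow hp.ne_zero hp.one_lt).ne'
  have h0 : p ^ p * q ≠ 0 := mul_ne_zero (pow_ne_zero _ hp.ne_zero) hq.ne_zero
  have hfin : Finite A := Nat.finite_of_card_ne_zero (by rwa [hcard])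
  have hQi : Q.index = p ^ p := by
    have := Q.card_mul_index
    rw [hQ, hcard, mul_comm] at this
    exact Nat.eq_of_mul_eq_mul_right hq.pos this
  have hlamQ : ∀ a, ∀ b ∈ Q, lam a b ∈ Q := fun a b hb =>
    lam_mem_of_card (by rw [hQ, hQi]; exact hcop.symm) a hb
  rcases exists_normal_card ho hcard with ⟨K, hK, hKc⟩ | ⟨V, hV, hVc, hfpf⟩
  · exact hA.false_of_normal_card hcop.symm hq.one_lt.ne' hpp (by rw [hcard, mul_comm])
      (by rwa [mul_comm]) hQn hQ hK hKc
  have hVi : V.index = q := by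
    have := V.card_mul_index
    rw [hVc, hcard] at this
    exact Nat.eq_of_mul_eq_mul_left (pow_pos hp.pos p) this
  have hfix : ∀ a, ∀ b ∈ Q, lam a b = b := fun a b hb =>
    lam_eq_self_of_prime hQ hlamQ hVi hfpf a hb
  obtain ⟨b, hb, hbo⟩ : ∃ b ∈ Q, addOrderOf b = q := by
    obtain ⟨b, hb⟩ := exists_prime_addOrderOf_dvd_card' (G := Q) q (by rw [hQ])
    exact ⟨b, b.2, by rw [AddSubgroup.addOrderOf_coe, hb]⟩
  have hbgen : AddSubgroup.zmultiples b = Q := AddSubgroup.eq_of_le_of_card_ge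
      (by rwa [AddSubgroup.zmultiples_le]) (by rw [Nat.card_zmultiples, hbo, hQ])
  -- The additive centralizer of `Q` is a left ideal.
  let L : LeftIdeal A :=
    { AddSubgroup.centralizer ({b} : Set A) with
      lam_mem := fun a c hc => by
        change lam a c ∈ AddSubgroup.centralizer ({b} : Set A)
        have hc' : c ∈ AddSubgroup.centralizer ({b} : Set A) := hc
        rw [AddSubgroup.mem_centralizer_singleton_iff] at hc' ⊢
        have := congrArg (lam a) hc'
        rwa [lam_add, lam_add, hfix a b hb] at this }
  have hL : ∀ c, c ∈ L.toSubgroup ↔ c + b = b + c := fun c =>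
    AddSubgroup.mem_centralizer_singleton_iff
  have hbL : b ∈ L.toSubgroup := (hL b).mpr rfl
  have hbq : b ^ q = 1 := by
    let LQ : LeftIdeal A := ⟨Q, fun a b hb => hlamQ a b hb⟩
    have h1 : Nat.card LQ.toSubgroup = q := hQ
    exact orderOf_dvd_iff_pow_eq_one.mp (h1 ▸ LQ.toSubgroup.orderOf_dvd_natCard
      (show b ∈ LQ.toSubgroup from hb))
  have hb1 : b ≠ 1 := by
    rintro rfl
    rw [one_eq_zero, addOrderOf_zero] at hbo
    exact hq.one_lt.ne hbo
  have hbV : b ∉ V := by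
    intro h
    have h1 : orderOf b ∣ p ^ p := hVc ▸ V.orderOf_dvd_natCard h
    exact hb1 (orderOf_eq_one_iff.mp
      (Nat.eq_one_of_dvd_coprimes hcop h1 (orderOf_dvd_of_pow_eq_one hbq)))
  let φ : V →* V := (MulAut.conjNormal b).toMonoidHom
  have hφ : ∀ v : V, ((φ v : V) : A) = b * v * b⁻¹ := fun v => MulAut.conjNormal_apply b v
  have hφq : φ^[q] = id := by
    have : ∀ (n : ℕ) (v : V), ((φ^[n] v : V) : A) = b ^ n * v * (b ^ n)⁻¹ := by
      intro n
      induction n with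
      | zero => intro v; simp
      | succ n ih =>
        intro v
        rw [Function.iterate_succ_apply, ih, hφ, pow_succ]
        group
    funext v
    apply Subtype.ext
    rw [this, hbq]
    simp
  have hφ1 : φ ≠ MonoidHom.id V := by
    intro h
    have hVnt : Nontrivial V := by
      rw [← Finite.one_lt_card_iff_nontrivial, hVc]
      exact Nat.one_lt_pow hp.ne_zero hp.one_lt
    obtain ⟨v, hv⟩ := exists_ne (1 : V)
    refine hv (Subtype.ext (hfpf b hbV v v.2 ?_))
    have h2 := hφ v
    rw [h] at h2
    exact (eq_mul_inv_iff_mul_eq.mp h2).symm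
  rcases eq_bot_or_eq_top_of_invariant ho hVc φ hφq hφ1 (L.toSubgroup.subgroupOf V) (fun v hv => by
    rw [Subgroup.mem_subgroupOf, hφ]
    exact mul_mem (mul_mem hbL hv) (inv_mem hbL)) with h | h
  · -- `v ↦ v + b - v` embeds `V` into `Q`.
    -- This uses that left cosets of a left ideal are the same for both operations.
    let f : V → Q := fun v => ⟨v + b + -v, hQn.conj_mem b hb v⟩
    have hf : Function.Injective f := by
      intro v w hvw
      have h1 : (v : A) + b + -v = w + b + -w := congrArg Subtype.val hvw
      have h2 : -(v : A) + w ∈ L.toSubgroup := by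
        rw [hL]
        have h3 := congrArg (fun t => -(v : A) + (t + w)) h1
        simp only [add_assoc, neg_add_cancel, add_zero, neg_add_cancel_left] at h3
        rw [add_assoc, ← h3]
      have h4 : (v : A)⁻¹ * w ∈ L.toSubgroup := by
        have h5 : (v : A)⁻¹ * w = lam (v : A)⁻¹ (-(v : A) + w) := by
          have h6 : (w : A) = v * lam (v : A)⁻¹ (-(v : A) + w) := by
            rw [mul_eq_add_lam, ← lam_mul, mul_inv_cancel, lam_one, add_neg_cancel_left]
          nth_rewrite 1 [h6]
          rw [inv_mul_cancel_left]
        rw [h5]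
        exact L.lam_mem _ h2
      have h5 : v⁻¹ * w ∈ L.toSubgroup.subgroupOf V := h4
      rw [h, Subgroup.mem_bot] at h5
      exact inv_mul_eq_one.mp h5
    have := Nat.card_le_card_of_injective f hf
    rw [hVc, hQ] at this
    omega
  · -- `Q` is central.
    rw [Subgroup.subgroupOf_eq_top] at h
    have h1 : p ^ p ∣ Nat.card L.toSubgroup := hVc ▸ Subgroup.card_dvd_of_le h
    have h2 : q ∣ Nat.card L.toSubgroup := by
      rw [← orderOf_eq_prime hbq hb1]
      exact L.toSubgroup.orderOf_dvd_natCard hbL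
    have h3 : L.toSubgroup = ⊤ := by
      rw [← Subgroup.card_eq_iff_eq_top, hcard]
      exact Nat.dvd_antisymm (hcard ▸ Subgroup.card_subgroup_dvd_card _)
        (hcop.mul_dvd_of_dvd_of_dvd h1 h2)
    obtain ⟨I, hI, hIc⟩ := exists_addNormal_of_central ho hcard hQ fun a c hc => by
      have h4 : a ∈ L.toSubgroup := h3 ▸ Subgroup.mem_top a
      rw [hL] at h4
      rw [← hbgen] at hc
      obtain ⟨n, rfl⟩ := hc
      exact AddCommute.zsmul_right (show AddCommute a b from h4) n
    exact hA.false_of_normal_card hcop hpp hq.one_lt.ne' hcard h0 hI hIc hV hVc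

end NotNormal

end SkewBrace

namespace SkewBrace

/-! ### Coordinates on a simple skew brace -/

/-- Additive conjugation by `y` on a normal subgroup, of order `q` if `q • y` acts trivially. -/
theorem exists_conj_hom {q : ℕ} {B : Type*} [AddGroup B] {V : AddSubgroup B} (hV : V.Normal) (y : B)
    (hy : ∀ v ∈ V, q • y + v = v + q • y) :
    ∃ φ : V →+ V, (∀ v : V, ((φ v : V) : B) = y + v + -y) ∧ φ^[q] = id := by
  let φ : V →+ V :=
    { toFun := fun v => ⟨y + v + -y, hV.conj_mem v v.2 y⟩
      map_zero' := by simp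
      map_add' := fun v w => Subtype.ext (by simp [add_assoc]) }
  have hφ : ∀ v : V, ((φ v : V) : B) = y + v + -y := fun v => rfl
  refine ⟨φ, hφ, ?_⟩
  have : ∀ (n : ℕ) (v : V), ((φ^[n] v : V) : B) = n • y + v + -(n • y) := by
    intro n
    induction n with
    | zero => intro v; simp
    | succ n ih =>
      intro v
      rw [Function.iterate_succ_apply, ih, hφ, succ_nsmul, neg_add_rev]
      simp only [add_assoc]
  funext v
  apply Subtype.ext
  rw [this, hy v v.2, add_neg_cancel_right]
  rfl

section Frames

variable {p q : ℕ} [Fact p.Prime] [Fact q.Prime] {A : Type*} [SkewBrace A]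

/-- Coordinates on a skew brace whose additive group is `V ⋊ C_q` and whose multiplicative group
is `C_q ⋊ V`. The left ideal `V` is the image of the field with `p ^ p` elements under `ι`, the
element `x` generates the normal Sylow `q`-subgroup of the multiplicative group, and it acts on `V`
by additive conjugation as multiplication by the `q`-th root of unity `ζ`. The last field says that
`V` is not normal in the multiplicative group. -/
structure Frame (q : ℕ) (ζ : GaloisField p p) (ι : GaloisField p p →+ A) (x : A) : Prop where
  root : ζ ^ q = 1
  root_ne : ζ ≠ 1
  injective : Function.Injective ι
  conj : ∀ y, x + ι y = ι (ζ * y) + x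
  decomp : ∀ a, ∃ (k : ℕ) (y : GaloisField p p), a = ι y + k • x
  nsmul_mem : ∃ u, q • x = ι u
  pow_eq : x ^ q = 1
  normal : ∀ a, ∃ s : ℕ, a * x = x ^ s * a
  stable : ∀ a y, ∃ z, lam a (ι y) = ι z
  not_comm : ∃ y, x * ι y ≠ ι y * x

/-- The additive group is `V ⋊ C_q` by `IsSimple.not_normal_card_q`, and since `V` is not an ideal,
the Sylow `q`-subgroup of the multiplicative group is normal. -/
theorem IsSimple.exists_frame (ho : orderOf (p : ZMod q) = p) (hlt : q < p ^ p)
    (hcard : Nat.card A = p ^ p * q) (hA : IsSimple A) :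
    ∃ (ζ : GaloisField p p) (ι : GaloisField p p →+ A) (x : A), Frame q ζ ι x := by
  have hp := (Fact.out : p.Prime)
  have hq := (Fact.out : q.Prime)
  have hcop := coprime_pow_of_orderOf ho
  have hpp : p ^ p ≠ 1 := (Nat.one_lt_pow hp.ne_zero hp.one_lt).ne'
  have h0 : p ^ p * q ≠ 0 := mul_ne_zero (pow_ne_zero _ hp.ne_zero) hq.ne_zero
  have hfin : Finite A := Nat.finite_of_card_ne_zero (by rwa [hcard])
  obtain ⟨V, hV, hVc, hfpf⟩ := (exists_addNormal_card ho hcard).resolve_left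
    fun ⟨Q, hQn, hQ⟩ => hA.not_normal_card_q ho hlt hcard hQn hQ
  obtain ⟨Q, hQn, hQ⟩ := (exists_normal_card ho hcard).resolve_right
    fun ⟨K, hK, hKc, _⟩ => hA.false_of_normal_card hcop hpp hq.one_lt.ne' hcard h0 hV hVc hK hKc
  have hVi : V.index = q := by
    have := V.card_mul_index
    rw [hVc, hcard] at this
    exact Nat.eq_of_mul_eq_mul_left (pow_pos hp.pos p) this
  have hVcop : Nat.Coprime (Nat.card V) V.index := by rwa [hVc, hVi]
  have hVnt : Nontrivial V := by
    rw [← Finite.one_lt_card_iff_nontrivial, hVc]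
    exact Nat.one_lt_pow hp.ne_zero hp.one_lt
  let L : LeftIdeal A := ⟨V, fun a b hb => lam_mem_of_card hVcop a hb⟩
  have hLc : Nat.card L.toSubgroup = p ^ p := hVc
  -- `V` is elementary abelian, because an additive element of order `q` acts on it.
  obtain ⟨y, hy⟩ := exists_prime_addOrderOf_dvd_card' (G := A) q
    (by rw [hcard]; exact ⟨_, mul_comm _ _⟩)
  have hyV : y ∉ V := by
    intro h
    have h1 : addOrderOf y ∣ p ^ p := hVc ▸ V.addOrderOf_dvd_natCard h
    rw [hy] at h1
    exact hq.one_lt.ne' (Nat.eq_one_of_dvd_coprimes hcop h1 dvd_rfl)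
  have hne : ∀ z ∉ V, ∀ φ : V →+ V, (∀ v : V, ((φ v : V) : A) = z + v + -z) →
      φ ≠ AddMonoidHom.id V := by
    intro z hz φ hφ h
    obtain ⟨v, hv⟩ := exists_ne (0 : V)
    refine hv (Subtype.ext (hfpf z hz v v.2 ?_))
    have h2 := hφ v
    rw [h] at h2
    exact (eq_add_neg_iff_add_eq.mp h2).symm
  obtain ⟨φ, hφ, hφq⟩ := exists_conj_hom hV y (q := q) (fun v _ => by
    rw [addOrderOf_dvd_iff_nsmul_eq_zero.mp (by rw [hy]), zero_add, add_zero])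
  obtain ⟨hc, hexp⟩ := commute_and_pow_eq_one (P := Multiplicative V) ho hVc φ.toMultiplicative hφq
    (fun h => hne y hyV φ hφ (AddMonoidHom.ext fun v => congrArg Multiplicative.toAdd
      (DFunLike.congr_fun h (Multiplicative.ofAdd v))))
  have hcomm : ∀ v ∈ V, ∀ w ∈ V, v + w = w + v := fun v hv w hw =>
    congrArg Subtype.val (show (⟨v, hv⟩ : V) + ⟨w, hw⟩ = ⟨w, hw⟩ + ⟨v, hv⟩ from
      hc (Multiplicative.ofAdd ⟨v, hv⟩) (Multiplicative.ofAdd ⟨w, hw⟩))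
  -- A generator `x` of the multiplicative Sylow `q`-subgroup.
  obtain ⟨x, hxQ, hxo⟩ : ∃ x ∈ Q, orderOf x = q := by
    obtain ⟨b, hb⟩ := exists_prime_orderOf_dvd_card' (G := Q) q (by rw [hQ])
    exact ⟨b, b.2, by rw [Subgroup.orderOf_coe, hb]⟩
  have hxgen : Subgroup.zpowers x = Q := Subgroup.eq_of_le_of_card_ge
      (by rwa [Subgroup.zpowers_le]) (by rw [Nat.card_zpowers, hxo, hQ])
  have hxV : x ∉ V := by
    intro h
    have h1 : orderOf x ∣ p ^ p := hLc ▸ L.toSubgroup.orderOf_dvd_natCard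
      (show x ∈ L.toSubgroup from h)
    rw [hxo] at h1
    exact hq.one_lt.ne' (Nat.eq_one_of_dvd_coprimes hcop h1 dvd_rfl)
  have hqx : q • x ∈ V := hVi ▸ V.nsmul_index_mem x
  obtain ⟨m, hm, hmq⟩ := exists_conj_hom hV x (q := q) (fun v hv => hcomm _ hqx v hv)
  let _ : AddCommGroup V := { (inferInstance : AddGroup V) with
    add_comm := fun v w => Subtype.ext (hcomm v v.2 w w.2) }
  let _ : Module (ZMod p) V := AddCommGroup.zmodModule (n := p) hexp
  obtain ⟨ζ, e, he⟩ := exists_galoisField_equiv ho hVc (m.toZModLinearMap p)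
    (LinearMap.ext fun v => by
      rw [Module.End.pow_apply]
      exact congrFun hmq v)
    (fun h => hne x hxV m hm (AddMonoidHom.ext fun v => LinearMap.congr_fun h v))
  have hem : ∀ z, ((e (ζ * z) : V) : A) = x + e z + -x := fun z => by
    rw [he]; exact hm (e z)
  have hepow : ∀ n : ℕ, e (ζ ^ n) = m^[n] (e 1) := by
    intro n
    induction n with
    | zero => simp
    | succ n ih =>
      rw [pow_succ', he, ih, Function.iterate_succ_apply']
      rfl
  refine ⟨ζ, V.subtype.comp (e : GaloisField p p →+ V), x, ?_, ?_, ?_, ?_, ?_, ?_, ?_, ?_, ?_, ?_⟩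
  · apply e.injective
    rw [hepow, hmq]
    rfl
  · rintro rfl
    refine hne x hxV m hm (AddMonoidHom.ext fun v => ?_)
    obtain ⟨z, rfl⟩ := e.surjective v
    have := he z
    rw [one_mul] at this
    exact this.symm
  · exact Subtype.val_injective.comp e.injective
  · intro z
    change x + (e z : A) = (e (ζ * z) : V) + x
    rw [hem, neg_add_cancel_right]
  · intro a
    have hQc : Nat.card (A ⧸ V) = q := hVi
    have hx0 : (x : A ⧸ V) ≠ 0 := fun h => hxV ((QuotientAddGroup.eq_zero_iff x).mp h)
    obtain ⟨k, hk⟩ := mem_multiples_of_prime_card hQc hx0 (g' := (a : A ⧸ V))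
    have h1 : a + -(k • x) ∈ V := by
      rw [← QuotientAddGroup.eq_zero_iff, QuotientAddGroup.mk_add, QuotientAddGroup.mk_neg,
        QuotientAddGroup.mk_nsmul, ← hk]
      exact add_neg_cancel _
    obtain ⟨z, hz⟩ := e.surjective ⟨_, h1⟩
    refine ⟨k, z, ?_⟩
    change a = (e z : A) + k • x
    rw [hz, neg_add_cancel_right]
  · obtain ⟨u, hu⟩ := e.surjective ⟨_, hqx⟩
    exact ⟨u, (congrArg Subtype.val hu).symm⟩
  · rw [← hxo, pow_orderOf_eq_one]
  · intro a
    have h1 : a * x * a⁻¹ ∈ Subgroup.zpowers x := hxgen ▸ hQn.conj_mem x hxQ a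
    obtain ⟨s, hs⟩ := mem_powers_iff_mem_zpowers.mpr h1
    exact ⟨s, eq_mul_inv_iff_mul_eq.mp hs |>.symm⟩
  · intro a z
    obtain ⟨w, hw⟩ := e.surjective ⟨_, lam_mem_of_card hVcop a (e z).2⟩
    exact ⟨w, (congrArg Subtype.val hw).symm⟩
  · by_contra! h
    have hcx : ∀ v ∈ L.toSubgroup, x * v = v * x := by
      intro v hv
      obtain ⟨z, hz⟩ := e.surjective ⟨v, hv⟩
      have h1 := h z
      have h2 : V.subtype.comp (e : GaloisField p p →+ V) z = v := congrArg Subtype.val hz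
      rwa [h2] at h1
    have hnorm : Subgroup.normalizer (L.toSubgroup : Set A) = ⊤ := by
      rw [← Subgroup.card_eq_iff_eq_top]
      refine Nat.dvd_antisymm (Subgroup.card_subgroup_dvd_card _) ?_
      rw [hcard]
      refine hcop.mul_dvd_of_dvd_of_dvd ?_ ?_
      · rw [← hLc]
        exact Subgroup.card_dvd_of_le Subgroup.le_normalizer
      · rw [← hxo]
        exact Subgroup.orderOf_dvd_natCard _ (Subgroup.centralizer_le_normalizer _
          (Subgroup.mem_centralizer_iff.mpr fun v hv => (hcx v hv).symm))
    exact hA.false_of_normal_card hcop hpp hq.one_lt.ne' hcard h0 hV hVc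
      (Subgroup.normalizer_eq_top_iff.mp hnorm) hLc

end Frames

end SkewBrace

namespace SkewBrace

section Action

variable {p q : ℕ} [Fact p.Prime] {A : Type*} [SkewBrace A]
  {ζ : GaloisField p p} {ι : GaloisField p p →+ A} {x : A}

theorem Frame.orderOf_root [Fact q.Prime] (h : Frame q ζ ι x) : orderOf ζ = q :=
  orderOf_eq_prime h.root h.root_ne

theorem Frame.root_pow_eq_iff [Fact q.Prime] (h : Frame q ζ ι x) (m n : ℕ) :
    ζ ^ m = ζ ^ n ↔ (m : ZMod q) = n := by
  rw [(isOfFinOrder_iff_pow_eq_one.mpr ⟨q, (Fact.out : q.Prime).pos, h.root⟩).pow_eq_pow_iff_modEq,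
    h.orderOf_root, ZMod.natCast_eq_natCast_iff]

theorem Frame.root_ne_zero [Fact q.Prime] (h : Frame q ζ ι x) : ζ ≠ 0 := by
  rintro rfl
  have := h.root
  rw [zero_pow (Fact.out : q.Prime).ne_zero] at this
  exact zero_ne_one this

theorem Frame.nsmul_add (h : Frame q ζ ι x) (k : ℕ) (y : GaloisField p p) :
    k • x + ι y = ι (ζ ^ k * y) + k • x := by
  induction k generalizing y with
  | zero => simp
  | succ k ih =>
    rw [succ_nsmul, add_assoc, h.conj, ← add_assoc, ih, pow_succ, mul_assoc, add_assoc]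

/-- The class of an element modulo `V` is determined by its action on `V`. -/
theorem Frame.pow_eq_pow (h : Frame q ζ ι x) {k l : ℕ} {y z : GaloisField p p}
    (hkl : ι y + k • x = ι z + l • x) : ζ ^ k = ζ ^ l := by
  have h1 := congrArg (fun t => t + ι 1) hkl
  simp only [add_assoc, h.nsmul_add, mul_one] at h1
  simp only [← add_assoc, ← map_add] at h1
  rw [add_comm y, add_comm z, map_add, map_add, add_assoc, add_assoc, hkl] at h1
  exact h.injective (add_right_cancel h1)

/-- The action of `λ_a` on `V`, in coordinates. -/
noncomputable def Frame.act (h : Frame q ζ ι x) (a : A) : GaloisField p p →+ GaloisField p p where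
  toFun y := (h.stable a y).choose
  map_zero' := h.injective (by rw [← (h.stable a 0).choose_spec, map_zero, lam_zero])
  map_add' y z := h.injective <|
    ((h.stable a (y + z)).choose_spec.symm.trans (by rw [map_add, lam_add])).trans
      ((congrArg₂ (· + ·) (h.stable a y).choose_spec (h.stable a z).choose_spec).trans
        (map_add ι _ _).symm)

theorem Frame.lam_apply (h : Frame q ζ ι x) (a : A) (y : GaloisField p p) :
    lam a (ι y) = ι (h.act a y) := (h.stable a y).choose_spec

/-- `λ_x` acts trivially on the quotient by `V`. -/
theorem Frame.lam_self [Fact q.Prime] (h : Frame q ζ ι x) : ∃ w, lam x x = ι w + x := by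
  have hq := (Fact.out : q.Prime)
  obtain ⟨k, y, hk⟩ := h.decomp (lam x x)
  -- `λ_x` acts on `A / V` by `x ↦ k x`, where `k ^ q = 1`, so that `k = 1` modulo `q`.
  have hiter : ∀ n : ℕ, ∃ z, lam (x ^ n) x = ι z + k ^ n • x := by
    intro n
    induction n with
    | zero => exact ⟨0, by simp [lam_one]⟩
    | succ n ih =>
      obtain ⟨z, hz⟩ := ih
      have h1 : ∀ m : ℕ, ∃ z, lam x (m • x) = ι z + (m * k) • x := by
        intro m
        induction m with
        | zero => exact ⟨0, by simp [lam_zero]⟩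
        | succ m ih =>
          obtain ⟨z', hz'⟩ := ih
          refine ⟨z' + ζ ^ (m * k) * y, ?_⟩
          rw [succ_nsmul, lam_add, hz', hk, add_assoc, ← add_assoc _ (ι y), h.nsmul_add, map_add,
            add_mul, add_nsmul, one_mul]
          simp only [add_assoc]
      obtain ⟨z', hz'⟩ := h1 (k ^ n)
      refine ⟨h.act x z + z', ?_⟩
      rw [pow_succ', lam_mul, hz, lam_add, h.lam_apply, hz', map_add, add_assoc, pow_succ]
  obtain ⟨z, hz⟩ := hiter q
  rw [h.pow_eq, lam_one] at hz
  have h2 : ζ ^ 1 = ζ ^ k ^ q := h.pow_eq_pow (y := 0) (z := z) (by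
    rw [map_zero, zero_add, one_nsmul]; exact hz)
  rw [h.root_pow_eq_iff, Nat.cast_pow, ZMod.pow_card, ZMod.natCast_eq_natCast_iff] at h2
  have h3 : 1 ≤ k := by
    by_contra h0
    have h4 : k = 0 := by omega
    rw [h4, Nat.modEq_zero_iff_dvd] at h2
    exact hq.one_lt.ne' (Nat.dvd_one.mp h2)
  obtain ⟨j, hj⟩ := (Nat.modEq_iff_dvd' h3).mp h2
  obtain ⟨u, hu⟩ := h.nsmul_mem
  refine ⟨y + j • u, ?_⟩
  rw [hk, show k = j * q + 1 by rw [mul_comm, ← hj]; omega, add_nsmul, mul_nsmul', hu, one_nsmul,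
    map_add, map_nsmul, add_assoc]

/-- `λ_x` is trivial modulo `V`, so on `V` it commutes with conjugation by `x`. -/
theorem Frame.act_self [Fact q.Prime] (ho : orderOf (p : ZMod q) = p) (h : Frame q ζ ι x)
    (y : GaloisField p p) : h.act x y = h.act x 1 * y := by
  obtain ⟨w, hw⟩ := h.lam_self
  refine apply_eq_apply_one_mul ho h.root h.root_ne _ (fun y => ?_) y
  have h1 := congrArg (lam x) (h.conj y)
  rw [lam_add, lam_add, hw, h.lam_apply, h.lam_apply, add_assoc, h.conj, ← add_assoc, ← add_assoc,
    ← map_add, ← map_add] at h1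
  have h2 := h.injective (add_right_cancel h1)
  rw [add_comm] at h2
  exact (add_right_cancel h2).symm

/-- If `λ_x` is not trivial on `V`, and neither is the analogous map of the opposite skew brace,
then `V` contains exactly one `a` for which `-a + x ∘ a` is fixed by `λ_x`. As the subgroup
generated by `x` is normal, this property of `a` passes to all `g ∘ a`. -/
theorem Frame.act_self_eq [Fact q.Prime] (ho : orderOf (p : ZMod q) = p) (h : Frame q ζ ι x) :
    h.act x 1 = 1 ∨ ζ * h.act x 1 = 1 := by
  obtain ⟨w, hw⟩ := h.lam_self
  set c := h.act x 1 with hc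
  have hact : ∀ y, lam x (ι y) = ι (c * y) := fun y => by rw [h.lam_apply, h.act_self ho]
  by_contra! hcon
  have hlamsub : ∀ g a b : A, lam g (-a + b) = -(g * a) + g * b := fun g a b => by
    rw [lam_add, lam_neg, lam, lam, neg_add_rev, neg_neg, add_assoc, add_neg_cancel_left]
  have hmove : ∀ a g, lam x (-a + x * a) = -a + x * a →
      lam x (-(g * a) + x * (g * a)) = -(g * a) + x * (g * a) := by
    intro a g ha
    have hpow : ∀ n : ℕ, lam x (-a + x ^ n * a) = -a + x ^ n * a := by
      intro n
      induction n with
      | zero => simp [lam_zero]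
      | succ n ih =>
        have h1 : -a + x ^ (n + 1) * a = (-a + x * a) + lam x (-a + x ^ n * a) := by
          rw [hlamsub, pow_succ', mul_assoc, add_assoc, add_neg_cancel_left]
        rw [h1, lam_add, ha, ih, ih]
    obtain ⟨s, hs⟩ := h.normal g⁻¹
    have hs' : x * g = g * x ^ s := by
      rw [← inv_mul_eq_iff_eq_mul, ← mul_assoc, hs, inv_mul_cancel_right]
    have hlam : ∀ b, lam x b = b → ∀ n : ℕ, lam (x ^ n) b = b := fun b hb n => by
      rw [lam_pow]
      exact Function.iterate_fixed hb n
    have h1 : -(g * a) + x * (g * a) = lam g (-a + x ^ s * a) := by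
      rw [hlamsub, ← mul_assoc, hs', mul_assoc]
    rw [h1, ← lam_mul, hs', lam_mul, hlam _ (hpow s)]
  have hiff : ∀ y, lam x (-ι y + x * ι y) = -ι y + x * ι y ↔ (c - 1) * (ζ * c - 1) * y + w = 0 := by
    intro y
    have h1 : -ι y + x * ι y = ι (-y + ζ * (c * y)) + x := by
      rw [mul_eq_add_lam, hact, h.conj, ← add_assoc, ← map_neg, ← map_add]
    rw [h1, lam_add, hw, hact, ← add_assoc, ← map_add, add_left_inj, h.injective.eq_iff,
      ← sub_eq_zero]
    constructor
    · intro h2; rw [← h2]; ring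
    · intro h2; rw [← h2]; ring
  have hD : (c - 1) * (ζ * c - 1) ≠ 0 :=
    mul_ne_zero (sub_ne_zero.mpr hcon.1) (sub_ne_zero.mpr hcon.2)
  have h0 := (hiff (-w / ((c - 1) * (ζ * c - 1)))).mpr (by
    rw [mul_div_cancel₀ _ hD, neg_add_cancel])
  have hall : ∀ y, (c - 1) * (ζ * c - 1) * y + w = 0 := fun y => by
    rw [← hiff]
    have h1 := hmove _ (ι y * (ι (-w / ((c - 1) * (ζ * c - 1))))⁻¹) h0
    rwa [inv_mul_cancel_right] at h1
  have h1 := hall 0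
  have h2 := hall 1
  rw [mul_zero, zero_add] at h1
  rw [h1, mul_one, add_zero] at h2
  exact hD h2

/-- Coordinates on the opposite skew brace. -/
theorem Frame.op [Fact q.Prime] (h : Frame q ζ ι x) :
    ∃ κ : GaloisField p p →+ Aᵃᵒᵖ, (∀ y, κ y = AddOpposite.op (ι y)) ∧
      Frame q ζ⁻¹ κ (AddOpposite.op x) := by
  let κ : GaloisField p p →+ Aᵃᵒᵖ :=
    { toFun := fun y => AddOpposite.op (ι y)
      map_zero' := by rw [map_zero]; rfl
      map_add' := fun y z => by rw [add_comm y, map_add]; rfl }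
  have hκ : ∀ y, κ y = AddOpposite.op (ι y) := fun y => rfl
  have hops : ∀ k : ℕ, k • AddOpposite.op x = AddOpposite.op (k • x) := fun k => rfl
  have hadd : ∀ a b : A, AddOpposite.op a + AddOpposite.op b = AddOpposite.op (b + a) :=
    fun a b => rfl
  have hmul : ∀ a b : A, AddOpposite.op a * AddOpposite.op b = AddOpposite.op (a * b) :=
    fun a b => rfl
  refine ⟨κ, hκ, ?_, ?_, ?_, ?_, ?_, ?_, ?_, ?_, ?_, ?_⟩
  · rw [inv_pow, h.root, inv_one]
  · exact inv_ne_one.mpr h.root_ne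
  · exact fun y z hyz => h.injective (AddOpposite.op_injective hyz)
  · intro y
    rw [hκ, hκ, hadd, hadd, h.conj, mul_inv_cancel_left₀ h.root_ne_zero]
  · intro a
    obtain ⟨k, y, hk⟩ := h.decomp a.unop
    refine ⟨k, (ζ ^ k)⁻¹ * y, ?_⟩
    apply AddOpposite.unop_injective
    rw [hκ, hops, hadd, hk, AddOpposite.unop_op, h.nsmul_add,
      mul_inv_cancel_left₀ (pow_ne_zero k h.root_ne_zero)]
  · obtain ⟨u, hu⟩ := h.nsmul_mem
    exact ⟨u, by rw [hops, hu, hκ]⟩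
  · exact congrArg AddOpposite.op h.pow_eq
  · intro a
    obtain ⟨s, hs⟩ := h.normal a.unop
    exact ⟨s, AddOpposite.unop_injective hs⟩
  · intro a y
    have h1 : lam a (κ y) =
        AddOpposite.op (a.unop + lam a.unop (ι y) + -a.unop) := by
      rw [← mul_eq_add_lam]
      rfl
    obtain ⟨k, z, hk⟩ := h.decomp a.unop
    refine ⟨ζ ^ k * h.act a.unop y, ?_⟩
    rw [h1, hκ, h.lam_apply]
    congr 1
    rw [add_neg_eq_iff_eq_add, hk, add_assoc, h.nsmul_add, ← add_assoc, ← add_assoc, ← map_add,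
      ← map_add, add_comm z]
  · obtain ⟨y, hy⟩ := h.not_comm
    exact ⟨y, fun h2 => hy (AddOpposite.op_injective h2)⟩

/-- Up to passing to the opposite skew brace, `λ_x` is trivial on `V`. -/
theorem IsSimple.exists_frame_lam_eq [Fact q.Prime] (ho : orderOf (p : ZMod q) = p)
    (hlt : q < p ^ p)
    (hcard : Nat.card A = p ^ p * q) (hA : IsSimple A) :
    (∃ (ζ : GaloisField p p) (ι : GaloisField p p →+ A) (x : A), Frame q ζ ι x ∧
      ∀ y, lam x (ι y) = ι y) ∨
    ∃ (ζ : GaloisField p p) (ι : GaloisField p p →+ Aᵃᵒᵖ) (x : Aᵃᵒᵖ), Frame q ζ ι x ∧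
      ∀ y, lam x (ι y) = ι y := by
  obtain ⟨ζ, ι, x, h⟩ := hA.exists_frame ho hlt hcard
  rcases h.act_self_eq ho with h1 | h1
  · exact Or.inl ⟨ζ, ι, x, h, fun y => by rw [h.lam_apply, h.act_self ho, h1, one_mul]⟩
  · obtain ⟨κ, hκ, hF⟩ := h.op
    refine Or.inr ⟨ζ⁻¹, κ, _, hF, fun y => ?_⟩
    have h2 : lam (AddOpposite.op x) (κ y) =
        AddOpposite.op (x + lam x (ι y) + -x) := by
      rw [← mul_eq_add_lam, hκ]
      rfl
    rw [h2, hκ, h.lam_apply, h.act_self ho, h.conj, ← mul_assoc, h1, one_mul, add_neg_cancel_right]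

end Action

end SkewBrace

/-! ### Regular groups of Frobenius-semilinear affine maps -/

section Affine

variable {p q : ℕ} [Fact p.Prime]

theorem pow_pow_congr {i j : ℕ} (hij : i ≡ j [MOD p]) (c : GaloisField p p) :
    c ^ p ^ i = c ^ p ^ j := by
  have h : ∀ n, c ^ p ^ n = c ^ p ^ (n % p) := by
    intro n
    nth_rewrite 1 [← Nat.mod_add_div n p]
    rw [pow_add, pow_mul]
    generalize c ^ p ^ (n % p) = d
    generalize n / p = k
    induction k with
    | zero => simp
    | succ k ih => rw [Nat.mul_succ, pow_add, pow_mul, ih, galoisField_pow_card]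
  rw [h i, h j, hij]

/-- A regular group of affine maps `w ↦ v + T v w` of the field, where `T v` is semilinear for the
`κ v`-th power of the Frobenius and of `p`-power order. -/
structure SemilinearRegular (T : GaloisField p p → GaloisField p p →+ GaloisField p p)
    (κ : GaloisField p p → ZMod p) : Prop where
  semilinear : ∀ v c y, T v (c * y) = c ^ p ^ (κ v).val * T v y
  zero : ∀ y, T 0 y = y
  comp : ∀ v w y, T (v + T v w) y = T v (T w y)
  add : ∀ v w, κ (v + T v w) = κ v + κ w
  inv : ∀ v, ∃ w, v + T v w = 0
  iterate : ∀ v y, (T v)^[p ^ p] y = y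

variable {T : GaloisField p p → GaloisField p p →+ GaloisField p p} {κ : GaloisField p p → ZMod p}

namespace SemilinearRegular

theorem map_zero (h : SemilinearRegular T κ) : κ 0 = 0 := by
  have h1 := h.add 0 0
  rw [h.zero, add_zero] at h1
  exact left_eq_add.mp h1

/-- A linear `T v` of `p`-power order is the multiplication by an element of `p`-power order,
which is `1`. -/
theorem eq_self (h : SemilinearRegular T κ) {v : GaloisField p p} (hv : κ v = 0)
    (y : GaloisField p p) : T v y = y := by
  have h1 : ∀ y, T v y = y * T v 1 := fun y => by
    have := h.semilinear v y 1
    rwa [hv, ZMod.val_zero, pow_zero, pow_one, mul_one] at this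
  have h2 : ∀ n : ℕ, (T v)^[n] 1 = T v 1 ^ n := by
    intro n
    induction n with
    | zero => simp
    | succ n ih => rw [Function.iterate_succ_apply', ih, h1, pow_succ]
  have h3 := h.iterate v 1
  rw [h2, galoisField_pow_card] at h3
  rw [h1, h3, mul_one]

theorem injective (h : SemilinearRegular T κ) (v : GaloisField p p) :
    Function.Injective (T v) := fun y z hyz => by
  rw [← h.iterate v y, ← h.iterate v z]
  have : ∀ n, 0 < n → (T v)^[n] y = (T v)^[n] z := by
    intro n hn
    obtain ⟨n, rfl⟩ := Nat.exists_eq_succ_of_ne_zero hn.ne'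
    rw [Function.iterate_succ_apply, Function.iterate_succ_apply, hyz]
  exact this _ (pow_pos (Fact.out : p.Prime).pos p)

theorem surjective (h : SemilinearRegular T κ) (v : GaloisField p p) :
    Function.Surjective (T v) := Finite.surjective_of_injective (h.injective v)

/-- The kernel of `κ` acts by translations, so `T v` depends on `κ v` only. -/
theorem eq_of_eq (h : SemilinearRegular T κ) {v v' : GaloisField p p} (hv : κ v = κ v') :
    κ (v - v') = 0 ∧ ∀ y, T v y = T v' y := by
  obtain ⟨w, hw⟩ := h.inv v'
  have h1 : κ (v + T v w) = 0 := by
    rw [h.add, hv, ← h.add, hw, h.map_zero]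
  have h2 : ∀ y, T v (T w y) = T v' (T w y) := fun y => by
    rw [← h.comp, ← h.comp, h.eq_self h1, hw, h.zero]
  have h3 : ∀ y, T v y = T v' y := fun y => by
    obtain ⟨z, rfl⟩ := h.surjective w y
    exact h2 z
  refine ⟨?_, h3⟩
  rwa [h3, ← neg_eq_of_add_eq_zero_right hw, ← sub_eq_add_neg] at h1

/-- The powers of `v` in the regular group. -/
theorem exists_iterate (h : SemilinearRegular T κ) (v : GaloisField p p) (n : ℕ) :
    ∃ w, κ w = n * κ v ∧ ∀ y, T w y = (T v)^[n] y := by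
  induction n with
  | zero => exact ⟨0, by simp [h.map_zero], h.zero⟩
  | succ n ih =>
    obtain ⟨w, hw, hT⟩ := ih
    refine ⟨v + T v w, ?_, fun y => ?_⟩
    · rw [h.add, hw]; push_cast; ring
    · rw [h.comp, hT, Function.iterate_succ_apply']

theorem iterate_prime (h : SemilinearRegular T κ) (v y : GaloisField p p) : (T v)^[p] y = y := by
  obtain ⟨w, hw, hT⟩ := h.exists_iterate v p
  rw [← hT, h.eq_self]
  rw [hw, CharP.cast_eq_zero, zero_mul]

theorem exists_eq (h : SemilinearRegular T κ) (hne : ∃ v, κ v ≠ 0) (k : ZMod p) :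
    ∃ v, κ v = k := by
  obtain ⟨v, hv⟩ := hne
  obtain ⟨w, hw, -⟩ := h.exists_iterate v (k * (κ v)⁻¹).val
  refine ⟨w, ?_⟩
  rw [hw, ZMod.natCast_zmod_val, inv_mul_cancel_right₀ hv]

/-- `T v` acts on the `p` cosets of the kernel of `κ`. The number of cosets it fixes is
divisible by `p`, and it fixes the kernel. -/
theorem apply_eq (h : SemilinearRegular T κ) (hne : ∃ v, κ v ≠ 0) (v w : GaloisField p p) :
    κ (T v w) = κ w := by
  have hp := (Fact.out : p.Prime)
  have hadd : ∀ u w, κ u = 0 → κ (u + w) = κ w := fun u w hu => by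
    have := h.add u w
    rwa [h.eq_self hu, hu, zero_add] at this
  have hker : ∀ u, κ u = 0 → κ (T v u) = 0 := fun u hu => by
    have h1 : κ (v + T v u) = κ v := by rw [h.add, hu, add_zero]
    have h2 := (h.eq_of_eq h1).1
    rwa [add_sub_cancel_left] at h2
  have hcong : ∀ a b, κ a = κ b → κ (T v a) = κ (T v b) := fun a b hab => by
    have h1 := hker _ (h.eq_of_eq hab).1
    have h2 := hadd _ (T v b) h1
    rwa [← map_add, sub_add_cancel] at h2
  choose r hr using h.exists_eq hne
  let f : Function.End (ZMod p) := fun k => κ (T v (r k))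
  have hf : ∀ a, f (κ a) = κ (T v a) := fun a => hcong _ _ (hr _)
  have hfn : ∀ (n : ℕ) a, (f ^ n) (κ a) = κ ((T v)^[n] a) := by
    intro n
    induction n with
    | zero => intro a; rfl
    | succ n ih =>
      intro a
      rw [pow_succ, Function.iterate_succ_apply, ← ih, ← hf]
      rfl
  have hfp : f ^ p ^ 1 = 1 := by
    funext k
    rw [← hr k, hfn, pow_one, h.iterate_prime]
    rfl
  have hcard := Equiv.Perm.card_fixedPoints_modEq hfp
  rw [ZMod.card] at hcard
  have hdvd := (Nat.modEq_zero_iff_dvd.mp (hcard.symm.trans (by simp [Nat.ModEq])))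
  have hpos : 0 < Fintype.card (Function.fixedPoints f) := by
    refine Fintype.card_pos_iff.mpr ⟨⟨0, ?_⟩⟩
    change f 0 = 0
    rw [← h.map_zero, hf, _root_.map_zero]
  have hle := Nat.le_of_dvd hpos hdvd
  have hset := set_fintype_card_eq_univ_iff (Function.fixedPoints f)
  have huniv := hset.mp (le_antisymm (set_fintype_card_le_univ _) (by rwa [ZMod.card]))
  have : κ w ∈ Function.fixedPoints f := huniv ▸ Set.mem_univ _
  rw [← hf]
  exact this

theorem map_add (h : SemilinearRegular T κ) (hne : ∃ v, κ v ≠ 0) (v w : GaloisField p p) :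
    κ (v + w) = κ v + κ w := by
  obtain ⟨w, rfl⟩ := h.surjective v w
  rw [h.add, h.apply_eq hne]

/-- After rescaling, every `T v` is a power of the Frobenius. -/
theorem exists_eq_frobenius [Fact q.Prime] (ho : orderOf (p : ZMod q) = p) {ζ : GaloisField p p}
    (hζ : ζ ^ q = 1) (hζ1 : ζ ≠ 1) (h : SemilinearRegular T κ) (hne : ∃ v, κ v ≠ 0) :
    ∃ d ≠ 0, ∀ v y, T v (d * y) = d * y ^ p ^ (κ v).val := by
  obtain ⟨v, hv⟩ := h.exists_eq hne 1
  obtain ⟨d, hd, hdT⟩ := exists_conj_frobenius ho hζ hζ1 (T v) (fun y => by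
    rw [h.semilinear, hv, ZMod.val_one, pow_one]) (h.iterate_prime v 1)
  refine ⟨d, hd, fun u y => ?_⟩
  obtain ⟨w, hw, hT⟩ := h.exists_iterate v (κ u).val
  rw [hv, ZMod.natCast_zmod_val, mul_one] at hw
  rw [(h.eq_of_eq hw.symm).2, hT]
  generalize (κ u).val = n
  induction n generalizing y with
  | zero => simp
  | succ n ih => rw [Function.iterate_succ_apply, hdT, ih, ← pow_mul, ← pow_succ']

end SemilinearRegular

end Affine

/-! ### The normal form -/

theorem nsmul_neg_add_add {B : Type*} [AddGroup B] (n : ℕ) (a b : B) :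
    n • (-a + b + a) = -a + n • b + a := by
  induction n with
  | zero => simp
  | succ n ih =>
    rw [succ_nsmul, ih, succ_nsmul]
    simp only [add_assoc, add_neg_cancel_left]

namespace SkewBrace

section NormalForm

variable {p q : ℕ} [Fact p.Prime] {A : Type*} [SkewBrace A]

/-- Coordinates in which the skew brace is completely determined by `ζ` and `κ`: the additive
group is `V ⋊ ⟨x⟩` with `V` the image of `ι` and `x` acting on `V` as multiplication by `ζ`, the
map `λ_x` is trivial, and `λ_v` for `v` in `V` acts on `V` as the `κ v`-th power of the Frobenius.
The values of `κ` are used as exponents through their representatives in `{0, ..., p - 1}`. -/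
structure NormalFrame (q : ℕ) (ζ : GaloisField p p) (κ : GaloisField p p →+ ZMod p)
    (ι : GaloisField p p →+ A) (x : A) : Prop where
  root : ζ ^ q = 1
  root_ne : ζ ≠ 1
  injective : Function.Injective ι
  conj : ∀ y, x + ι y = ι (ζ * y) + x
  decomp : ∀ a, ∃ (k : ℕ) (y : GaloisField p p), a = ι y + k • x
  nsmul_eq : q • x = 0
  lam_x : ∀ a, lam x a = a
  pow_eq : ∀ n : ℕ, x ^ n = n • x
  lam_ι : ∀ v w, lam (ι v) (ι w) = ι (w ^ p ^ (κ v).val)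
  lam_ι_x : ∀ v, lam (ι v) x = -ι v + p ^ (κ v).val • x + ι v
  frob : ∀ y, κ (y ^ p) = κ y
  ne_zero : ∃ y, κ y ≠ 0

variable {ζ : GaloisField p p} {ι : GaloisField p p →+ A} {x : A}

/-- If `λ_x` is trivial on `V`, then it moves `x` by a translation, whose order divides both `p` and
`q`. -/
theorem Frame.lam_x_eq [Fact q.Prime] (ho : orderOf (p : ZMod q) = p) (h : Frame q ζ ι x)
    (hid : ∀ y, lam x (ι y) = ι y) (a : A) : lam x a = a := by
  have hq := (Fact.out : q.Prime)
  obtain ⟨w, hw⟩ := h.lam_self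
  have hiter : ∀ n : ℕ, lam (x ^ n) x = ι (n • w) + x := by
    intro n
    induction n with
    | zero => simp [lam_one]
    | succ n ih => rw [pow_succ', lam_mul, ih, lam_add, hid, hw, ← add_assoc, ← map_add, succ_nsmul]
  have h1 := hiter q
  rw [h.pow_eq, lam_one, right_eq_add, ← map_zero ι, h.injective.eq_iff, nsmul_eq_mul,
    mul_eq_zero, CharP.cast_eq_zero_iff (GaloisField p p) p] at h1
  have h2 : w = 0 := h1.resolve_left fun h3 =>
    ne_of_orderOf ho ((Nat.prime_dvd_prime_iff_eq Fact.out hq).mp h3)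
  rw [h2, map_zero, zero_add] at hw
  obtain ⟨k, y, rfl⟩ := h.decomp a
  rw [lam_add, lam_nsmul, hid, hw]

/-- If `λ_x` is trivial on `V`, then `V` with the circle operation is a regular group of semilinear
affine maps of `V`, and its exponent map `κ` also determines how `V` acts on `x`. -/
theorem Frame.exists_normalFrame [Finite A] [Fact q.Prime] (ho : orderOf (p : ZMod q) = p)
    (h : Frame q ζ ι x) (hid : ∀ y, lam x (ι y) = ι y) :
    ∃ (κ : GaloisField p p →+ ZMod p) (ι' : GaloisField p p →+ A), NormalFrame q ζ κ ι' x := by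
  have hp := (Fact.out : p.Prime)
  have hq := (Fact.out : q.Prime)
  have hlam := h.lam_x_eq ho hid
  have hpow : ∀ n : ℕ, x ^ n = n • x := by
    intro n
    induction n with
    | zero => rw [pow_zero, zero_nsmul, one_eq_zero]
    | succ n ih => rw [pow_succ', mul_eq_add_lam, hlam, ih, succ_nsmul']
  have hlampow : ∀ (n : ℕ) a, lam (x ^ n) a = a := fun n a => by
    rw [lam_pow]
    exact Function.iterate_fixed (hlam a) n
  have hqx : q • x = 0 := by rw [← hpow, h.pow_eq, one_eq_zero]
  -- Conjugation by `ι v` in the multiplicative group raises `x` to the power `s v`.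
  choose s hs using fun v => h.normal (ι v)
  have hlamx : ∀ v, lam (ι v) x = -ι v + s v • x + ι v := fun v => by
    rw [lam, hs, mul_eq_add_lam, hlampow, hpow, add_assoc]
  have hact : ∀ v y, h.act (ι v) (ζ * y) = ζ ^ s v * h.act (ι v) y := by
    intro v y
    have h1 := congrArg (lam (ι v)) (h.conj y)
    rw [lam_add, lam_add, hlamx, h.lam_apply, h.lam_apply] at h1
    simp only [add_assoc, h.nsmul_add, ← map_neg] at h1
    simp only [← add_assoc, ← _root_.map_add] at h1
    have h2 := h.injective (add_right_cancel h1)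
    linear_combination -h2
  have hact0 : ∀ v y, h.act (ι v) y = 0 → y = 0 := fun v y hy => by
    have h1 := h.lam_apply (ι v) y
    rw [hy, map_zero, ← lam_zero (ι v)] at h1
    have h2 := lam_injective _ h1
    rwa [← map_zero ι, h.injective.eq_iff] at h2
  choose i hi1 hi2 using fun v => exists_frobenius_semilinear ho h.root h.root_ne (h.act (ι v))
    (fun h1 => one_ne_zero (hact0 v 1 h1)) (hact v)
  have hval : ∀ (n : ℕ) (c : GaloisField p p), c ^ p ^ (n : ZMod p).val = c ^ p ^ n := fun n c =>
    pow_pow_congr (by rw [ZMod.val_natCast]; exact Nat.mod_modEq n p) c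
  have hmul : ∀ v w, ι v * ι w = ι (v + h.act (ι v) w) := fun v w => by
    rw [mul_eq_add_lam, h.lam_apply, _root_.map_add]
  have hcomp : ∀ v w y, h.act (ι (v + h.act (ι v) w)) y = h.act (ι v) (h.act (ι w) y) := by
    intro v w y
    apply h.injective
    rw [← h.lam_apply, ← hmul, lam_mul, h.lam_apply, h.lam_apply]
  have hcast : ∀ m n : ℕ, ζ ^ p ^ m = ζ ^ p ^ n → (m : ZMod p) = n := by
    intro m n hmn
    rw [h.root_pow_eq_iff, Nat.cast_pow, Nat.cast_pow,
      (isOfFinOrder_iff_pow_eq_one.mpr ⟨p, hp.pos, by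
        nth_rewrite 2 [← ho]; exact pow_orderOf_eq_one _⟩).pow_eq_pow_iff_modEq, ho] at hmn
    exact (ZMod.natCast_eq_natCast_iff _ _ _).mpr hmn
  -- `V` is a subgroup of order `p ^ p` of the multiplicative group.
  let L : LeftIdeal A :=
    { ι.range with
      lam_mem := by
        rintro a _ ⟨y, rfl⟩
        exact ⟨_, (h.lam_apply a y).symm⟩ }
  have hLc : Nat.card L.toSubgroup = p ^ p := by
    rw [← card_galoisField_self (p := p)]
    exact (Nat.card_congr (AddMonoidHom.ofInjective h.injective).toEquiv).symm
  have hreg : SemilinearRegular (fun v => h.act (ι v)) (fun v => (i v : ZMod p)) := by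
    refine ⟨fun v c y => ?_, fun y => ?_, hcomp, fun v w => ?_, fun v => ?_, fun v y => ?_⟩
    · rw [hval, hi2]
    · apply h.injective
      rw [← h.lam_apply, map_zero, ← one_eq_zero, lam_one]
    · rw [← Nat.cast_add]
      refine hcast _ _ ?_
      have h1 := hcomp v w (ζ * 1)
      rw [hi2, hi2, hi2, hcomp, ← pow_mul, ← pow_add, add_comm (i w)] at h1
      exact mul_right_cancel₀ (fun h2 => one_ne_zero (hact0 w 1 (hact0 v _ h2))) h1
    · obtain ⟨y, hy⟩ : (ι v)⁻¹ ∈ L.toSubgroup := L.toSubgroup.inv_mem ⟨v, rfl⟩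
      refine ⟨y, h.injective ?_⟩
      rw [← hmul, show ι y = (ι v)⁻¹ from hy, mul_inv_cancel, one_eq_zero, map_zero]
    · have h1 : ι v ^ p ^ p = 1 := orderOf_dvd_iff_pow_eq_one.mp
        (hLc ▸ L.toSubgroup.orderOf_dvd_natCard (show ι v ∈ L.toSubgroup from ⟨v, rfl⟩))
      have h2 : ∀ n : ℕ, lam (ι v ^ n) (ι y) = ι ((h.act (ι v))^[n] y) := by
        intro n
        induction n with
        | zero => rw [pow_zero, lam_one]; rfl
        | succ n ih => rw [pow_succ', lam_mul, ih, h.lam_apply, Function.iterate_succ_apply']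
      apply h.injective
      rw [← h2, h1, lam_one]
  have hsx : ∀ v, s v • x = p ^ i v • x := fun v => by
    have h1 := hi1 v
    rw [h.root_pow_eq_iff, ZMod.natCast_eq_natCast_iff] at h1
    exact nsmul_eq_nsmul_iff_modEq.mpr (h1.of_dvd (addOrderOf_dvd_of_nsmul_eq_zero hqx))
  have hne : ∃ v, (i v : ZMod p) ≠ 0 := by
    by_contra! hall
    obtain ⟨v, hv⟩ := h.not_comm
    refine hv ?_
    have h1 : s v • x = x := by
      have h2 : p ^ i v ≡ 1 [MOD q] := by
        have h3 := hval (i v) ζ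
        rw [hall v, ZMod.val_zero, pow_zero, h.root_pow_eq_iff, ZMod.natCast_eq_natCast_iff] at h3
        exact h3.symm
      rw [hsx]
      nth_rewrite 2 [← one_nsmul x]
      exact nsmul_eq_nsmul_iff_modEq.mpr (h2.of_dvd (addOrderOf_dvd_of_nsmul_eq_zero hqx))
    rw [hs, hpow, h1]
  obtain ⟨d, hd, hdT⟩ := hreg.exists_eq_frobenius ho h.root h.root_ne hne
  let κ : GaloisField p p →+ ZMod p :=
    { toFun := fun y => (i (d * y) : ZMod p)
      map_zero' := by rw [mul_zero]; exact hreg.map_zero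
      map_add' := fun y z => by rw [mul_add]; exact hreg.map_add hne _ _ }
  obtain ⟨v₁, hv₁⟩ := hreg.exists_eq hne 1
  have hqx' : ∀ v, p ^ (i v : ZMod p).val • x = p ^ i v • x := fun v => by
    have h1 := hval (i v) ζ
    rw [h.root_pow_eq_iff, ZMod.natCast_eq_natCast_iff] at h1
    exact nsmul_eq_nsmul_iff_modEq.mpr (h1.of_dvd (addOrderOf_dvd_of_nsmul_eq_zero hqx))
  refine ⟨κ, ι.comp (AddMonoidHom.mulLeft d), h.root, h.root_ne, ?_, ?_, ?_, hqx, hlam, hpow,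
    ?_, ?_, ?_, ?_⟩
  · exact h.injective.comp (mul_right_injective₀ hd)
  · intro y
    change x + ι (d * y) = ι (d * (ζ * y)) + x
    rw [h.conj, mul_left_comm]
  · intro a
    obtain ⟨k, y, hk⟩ := h.decomp a
    refine ⟨k, d⁻¹ * y, ?_⟩
    change a = ι (d * (d⁻¹ * y)) + k • x
    rw [mul_inv_cancel_left₀ hd, hk]
  · intro v w
    change lam (ι (d * v)) (ι (d * w)) = ι (d * w ^ p ^ (i (d * v) : ZMod p).val)
    rw [h.lam_apply, ← hdT]
  · intro v
    change lam (ι (d * v)) x = -ι (d * v) + p ^ (i (d * v) : ZMod p).val • x + ι (d * v)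
    rw [hlamx, hsx, hqx']
  · intro y
    change (i (d * y ^ p) : ZMod p) = i (d * y)
    have h1 := hreg.apply_eq hne v₁ (d * y)
    have h2 := hdT v₁ y
    rw [hv₁, ZMod.val_one, pow_one] at h2
    rwa [h2] at h1
  · obtain ⟨v, hv⟩ := hne
    refine ⟨d⁻¹ * v, ?_⟩
    change (i (d * (d⁻¹ * v)) : ZMod p) ≠ 0
    rwa [mul_inv_cancel_left₀ hd]

theorem NormalFrame.nsmul_add {κ : GaloisField p p →+ ZMod p} (h : NormalFrame q ζ κ ι x)
    (k : ℕ) (y : GaloisField p p) : k • x + ι y = ι (ζ ^ k * y) + k • x := by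
  induction k generalizing y with
  | zero => simp
  | succ k ih =>
    rw [succ_nsmul, add_assoc, h.conj, ← add_assoc, ih, pow_succ, mul_assoc, add_assoc]

theorem NormalFrame.lam_nsmul_x {κ : GaloisField p p →+ ZMod p} (h : NormalFrame q ζ κ ι x)
    (k : ℕ) (a : A) : lam (k • x) a = a := by
  rw [← h.pow_eq, lam_pow]
  exact Function.iterate_fixed (h.lam_x a) k

/-- Replacing `x` by a multiple replaces `ζ` by a power. -/
theorem NormalFrame.pow {κ : GaloisField p p →+ ZMod p} (hq : q.Prime)
    (h : NormalFrame q ζ κ ι x) {ξ : GaloisField p p} (hξ : ξ ^ q = 1) (hξ1 : ξ ≠ 1) :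
    ∃ y : A, NormalFrame q ξ κ ι y := by
  have : NeZero q := ⟨hq.ne_zero⟩
  have : Fact q.Prime := ⟨hq⟩
  have hprim : ∀ z : GaloisField p p, z ^ q = 1 → z ≠ 1 → IsPrimitiveRoot z q := fun z h1 h2 =>
    (orderOf_eq_prime h1 h2) ▸ IsPrimitiveRoot.orderOf z
  obtain ⟨r, -, hr⟩ := (hprim ζ h.root h.root_ne).eq_pow_of_pow_eq_one hξ
  obtain ⟨t, -, ht⟩ := (hprim ξ hξ hξ1).eq_pow_of_pow_eq_one h.root
  -- `r * t = 1` modulo `q`, so that `x` is a multiple of `r • x`.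
  have hrt : r * t ≡ 1 [MOD q] := by
    have h1 : ζ ^ (r * t) = ζ ^ 1 := by rw [pow_mul, hr, ht, pow_one]
    rwa [(isOfFinOrder_iff_pow_eq_one.mpr ⟨q, hq.pos, h.root⟩).pow_eq_pow_iff_modEq,
      orderOf_eq_prime h.root h.root_ne] at h1
  have hrtx : t • r • x = x := by
    rw [smul_smul, mul_comm]
    nth_rewrite 2 [← one_nsmul x]
    exact nsmul_eq_nsmul_iff_modEq.mpr (hrt.of_dvd (addOrderOf_dvd_of_nsmul_eq_zero h.nsmul_eq))
  refine ⟨r • x, hξ, hξ1, h.injective, fun y => ?_, fun a => ?_, ?_, h.lam_nsmul_x r, fun n => ?_,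
    h.lam_ι, fun v => ?_, h.frob, h.ne_zero⟩
  · rw [h.nsmul_add, hr]
  · obtain ⟨k, y, hk⟩ := h.decomp a
    exact ⟨k * t, y, by rw [hk, mul_smul, hrtx]⟩
  · rw [smul_comm, h.nsmul_eq, nsmul_zero]
  · rw [← h.pow_eq, ← pow_mul, h.pow_eq, h.pow_eq, mul_comm, mul_smul]
  · rw [lam_nsmul, h.lam_ι_x, nsmul_neg_add_add, smul_comm]

end NormalForm

end SkewBrace

/-! ### Comparison with the skew brace `B` -/

/-- The multiplication `η ∘ μ = η α(μ)` in the skew brace of `G`, for `(η, α)` in `G`. -/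
theorem Hol.Brace.mul_eq {N : Type*} [Group N] {G : Subgroup (Hol N)} (hG : Hol.IsRegular G)
    {g : Hol N} (hg : g ∈ G) (b : N) :
    ((show Hol.Brace hG from g.left) * (show Hol.Brace hG from b) : Hol.Brace hG) =
      (show Hol.Brace hG from g.left * g.right b) := by
  have h1 : hG.equiv.symm g.left = ⟨g, hg⟩ := by
    rw [Equiv.symm_apply_eq]
    rfl
  have h2 : (hG.equiv.symm b : Hol N).left = b := hG.equiv.apply_symm_apply b
  change ((hG.equiv.symm g.left : Hol N) * (hG.equiv.symm b : Hol N)).left = _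
  rw [h1, SemidirectProduct.mul_left, h2]
  rfl

namespace PPQ

open Matrix

section Compare

variable {p q : ℕ} [Fact p.Prime] {M : GL (Fin p) (ZMod p)}

theorem J_pow_conj_pow (hM : Admissible q M) (k j : ℕ) :
    J p ^ k * M ^ j * (J p ^ k)⁻¹ = M ^ (j * p ^ k) := by
  induction k generalizing j with
  | zero => simp
  | succ k ih =>
    have h1 : J p * M ^ j * (J p)⁻¹ = M ^ (p * j) := by
      rw [← conj_pow, hM.conj_eq, ← pow_mul]
    have h2 : J p ^ (k + 1) * M ^ j * (J p ^ (k + 1))⁻¹ =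
        J p ^ k * (J p * M ^ j * (J p)⁻¹) * (J p ^ k)⁻¹ := by
      rw [pow_succ]; group
    rw [h2, h1, ih]
    congr 1
    ring

theorem exists_eq_block (n : N M) :
    ∃ (k : ℕ) (v : Fin p → ZMod p), (n : GL (Fin p ⊕ Unit) (ZMod p)) = block (M ^ k) v := by
  obtain ⟨_, i, v, rfl⟩ := n
  obtain ⟨k, hk⟩ := mem_powers_iff_mem_zpowers.mpr (show M ^ i ∈ Subgroup.zpowers M from ⟨i, rfl⟩)
  exact ⟨k, v, congrArg (fun T => block T v) hk.symm⟩

/-- A skew brace with a normal form is isomorphic to `B`, once the field is identified with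
`𝔽_p ^ p` in such a way that `ζ`, the Frobenius and `κ` become `M`, `J` and the last coordinate. -/
theorem isomorphic_of_normalFrame (hq : q.Prime) (hM : Admissible q M) {A : Type*} [SkewBrace A]
    {ζ : GaloisField p p} {κ : GaloisField p p →+ ZMod p} {ι : GaloisField p p →+ A} {x : A}
    (h : SkewBrace.NormalFrame q ζ κ ι x) {g : (Fin p → ZMod p) ≃+ GaloisField p p}
    (hgM : ∀ u, g (M.val *ᵥ u) = ζ * g u) (hgJ : ∀ u, g ((J p).val *ᵥ u) = g u ^ p)
    (hgκ : ∀ u, κ (g u) = kap u) : SkewBrace.Isomorphic A (B hM) := by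
  have hgMk : ∀ (k : ℕ) u, g ((M ^ k).val *ᵥ u) = ζ ^ k * g u := by
    intro k
    induction k with
    | zero => intro u; simp
    | succ k ih =>
      intro u
      rw [pow_succ, Units.val_mul, ← mulVec_mulVec, ih, hgM, pow_succ, mul_assoc]
  have hgJk : ∀ (k : ℕ) u, g ((J p ^ k).val *ᵥ u) = g u ^ p ^ k := by
    intro k
    induction k with
    | zero => intro u; simp
    | succ k ih =>
      intro u
      rw [pow_succ', Units.val_mul, ← mulVec_mulVec, hgJ, ih, ← pow_mul, pow_succ]
  have hnsmul : ∀ {k l : ℕ}, M ^ k = M ^ l → k • x = l • x := by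
    intro k l hkl
    rw [pow_eq_pow_iff_modEq, hM.orderOf_eq] at hkl
    exact nsmul_eq_nsmul_iff_modEq.mpr (hkl.of_dvd (addOrderOf_dvd_of_nsmul_eq_zero h.nsmul_eq))
  -- The isomorphism sends `(M ^ k | v)` to `ι v + k • x`.
  choose k v hkv using exists_eq_block (M := M)
  let Ψ : N M → A := fun n => ι (g (v n)) + k n • x
  have hΨ : ∀ (n : N M) (l : ℕ) w, (n : GL (Fin p ⊕ Unit) (ZMod p)) = block (M ^ l) w →
      Ψ n = ι (g w) + l • x := by
    intro n l w hn
    obtain ⟨h1, h2⟩ := block_inj ((hkv n).symm.trans hn)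
    change ι (g (v n)) + k n • x = _
    rw [h2, hnsmul h1]
  have hΨmul : ∀ n n' : N M, Ψ (n * n') = Ψ n + Ψ n' := by
    intro n n'
    rw [hΨ (n * n') (k n + k n') (v n + (M ^ k n).val *ᵥ v n') (by
      rw [Subgroup.coe_mul, hkv n, hkv n', block_mul, pow_add]), map_add, map_add, hgMk, add_nsmul]
    change _ = ι (g (v n)) + k n • x + (ι (g (v n')) + k n' • x)
    rw [add_assoc, add_assoc, ← add_assoc (k n • x), h.nsmul_add, add_assoc]
  have hinj : Function.Injective Ψ := by
    have hΨone : Ψ 1 = 0 := by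
      have := hΨmul 1 1
      rwa [mul_one, left_eq_add] at this
    have hker : ∀ n, Ψ n = 0 → n = 1 := by
      intro n hn
      have h1 : ι (g (v n)) + k n • x = 0 := hn
      have h2 : ζ ^ k n = 1 := by
        have h3 := congrArg (fun t => t + ι 1) h1
        simp only [zero_add, add_assoc, h.nsmul_add, mul_one] at h3
        rw [← add_assoc, ← map_add, add_comm (g (v n)), map_add, add_assoc, h1, add_zero] at h3
        exact h.injective h3
      have h3 : q ∣ k n := by
        rw [← @orderOf_eq_prime _ _ ζ q ⟨hq⟩ h.root h.root_ne]
        exact orderOf_dvd_of_pow_eq_one h2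
      have h4 : M ^ k n = 1 := by
        rw [← hM.orderOf_eq] at h3
        exact orderOf_dvd_iff_pow_eq_one.mp h3
      have h5 : k n • x = 0 := by
        obtain ⟨c, hc⟩ := h3
        rw [hc, mul_comm, mul_smul, h.nsmul_eq, nsmul_zero]
      rw [h5, add_zero, ← map_zero ι, h.injective.eq_iff, map_eq_zero_iff g g.injective] at h1
      exact Subtype.ext (by rw [hkv n, h4, h1, block_one]; rfl)
    intro n n' hnn
    have h1 := hΨmul (n * n'⁻¹) n'
    rw [inv_mul_cancel_right, hnn, right_eq_add] at h1
    exact mul_inv_eq_one.mp (hker _ h1)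
  have hsurj : Function.Surjective Ψ := by
    intro a
    obtain ⟨l, y, hl⟩ := h.decomp a
    obtain ⟨w, rfl⟩ := g.surjective y
    refine ⟨⟨block (M ^ l) w, l, w, by rw [zpow_natCast]⟩, ?_⟩
    rw [hl, hΨ _ l w rfl]
  have hΨstar : ∀ s ∈ G hM, ∀ b : N M,
      Ψ (s.right b) = SkewBrace.lam (Ψ s.left) (Ψ b) := by
    intro s hs b
    obtain ⟨i, m, u, hmu, hl, hr⟩ := shape_of_mem hM hs
    obtain ⟨i', hi'⟩ :=
      mem_powers_iff_mem_zpowers.mpr (show M ^ i ∈ Subgroup.zpowers M from ⟨i, rfl⟩)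
    replace hi' : M ^ i' = M ^ i := hi'
    have hJ : J p ^ m = J p ^ (kap u).val := by
      refine pow_eq_pow_of_modEq ?_ (J_pow_p p)
      rw [← ZMod.natCast_eq_natCast_iff, hmu, ZMod.natCast_zmod_val]
    rw [← hi'] at hl
    have h1 : ∀ a, SkewBrace.lam (Ψ s.left) a = SkewBrace.lam (ι (g u)) a := by
      intro a
      have h2 : Ψ s.left = x ^ i' * ι (g u) := by
        rw [hΨ _ _ _ hl, hgMk, ← h.nsmul_add, SkewBrace.mul_eq_add_lam, h.pow_eq, h.lam_nsmul_x]
      rw [h2, SkewBrace.lam_mul, h.pow_eq, h.lam_nsmul_x]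
    have h2 : (s.right b : GL (Fin p ⊕ Unit) (ZMod p)) = block (M ^ (k b * p ^ (kap u).val))
        (-u + (J p ^ (kap u).val).val *ᵥ v b + (M ^ (k b * p ^ (kap u).val)).val *ᵥ u) := by
      rw [hr, hJ, hkv b, block_conj, J_pow_conj_pow hM, mulVec_neg, sub_neg_eq_add]
    rw [hΨ _ _ _ h2, h1]
    change _ = SkewBrace.lam (ι (g u)) (ι (g (v b)) + k b • x)
    rw [SkewBrace.lam_add, h.lam_ι, SkewBrace.lam_nsmul, h.lam_ι_x, nsmul_neg_add_add, smul_smul,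
      hgκ, add_assoc (-ι (g u)), h.nsmul_add, map_add g, map_add g, hgMk, hgJk, map_neg,
      ← map_neg ι, ← add_assoc, ← add_assoc,
      ← map_add, ← map_add, add_comm (-(g u))]
  let Φ : B hM ≃+* A :=
    { Equiv.ofBijective Ψ ⟨hinj, hsurj⟩ with
      map_add' := hΨmul
      map_mul' := fun a b => by
        obtain ⟨s, hs, rfl⟩ := exists_left' hM a
        calc Ψ _ = Ψ (s.left * s.right b) :=
              congrArg Ψ (Hol.Brace.mul_eq (isRegular_G hM) hs b)
          _ = Ψ s.left + Ψ (s.right b) := hΨmul _ _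
          _ = Ψ s.left + SkewBrace.lam (Ψ s.left) (Ψ b) := congrArg (Ψ s.left + ·) (hΨstar s hs b)
          _ = Ψ s.left * Ψ b := (SkewBrace.mul_eq_add_lam _ _).symm }
  exact ⟨Φ.symm⟩

theorem isomorphic_of_frame [Fact q.Prime] (ho : orderOf (p : ZMod q) = p) (hM : Admissible q M)
    {A : Type*} [SkewBrace A] [Finite A] {ζ : GaloisField p p} {ι : GaloisField p p →+ A} {x : A}
    (h : SkewBrace.Frame q ζ ι x) (hid : ∀ y, SkewBrace.lam x (ι y) = ι y) :
    SkewBrace.Isomorphic A (B hM) := by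
  obtain ⟨κ, ι', hN⟩ := h.exists_normalFrame ho hid
  obtain ⟨ξ, hξ, hξ1, hκ⟩ := exists_admissible_coordinates ho hM
  obtain ⟨g, hgM, hgJ, hgκ⟩ := hκ κ hN.frob hN.ne_zero
  obtain ⟨y, hy⟩ := hN.pow Fact.out hξ hξ1
  exact isomorphic_of_normalFrame Fact.out hM hy hgM hgJ hgκ

end Compare

end PPQ

theorem SkewBrace.Isomorphic.of_op {A C : Type*} [SkewBrace A] [SkewBrace C]
    (h : SkewBrace.Isomorphic Aᵃᵒᵖ C) : SkewBrace.Isomorphic A Cᵃᵒᵖ := by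
  obtain ⟨e⟩ := h
  refine ⟨{ toFun := fun a => AddOpposite.op (e (AddOpposite.op a))
            invFun := fun c => (e.symm c.unop).unop
            left_inv := fun a => by simp
            right_inv := fun c => by simp
            map_mul' := fun a b => ?_
            map_add' := fun a b => ?_ }⟩
  · exact congrArg AddOpposite.op (map_mul e (AddOpposite.op a) (AddOpposite.op b))
  · exact congrArg AddOpposite.op (map_add e (AddOpposite.op b) (AddOpposite.op a))

theorem theorem6p1 (p q : ℕ) [Fact p.Prime] (hq : q.Prime) (hpq : q ∣ (p ^ p - 1) / (p - 1)) :
    (∃ M : Matrix.GeneralLinearGroup (Fin p) (ZMod p), PPQ.Admissible q M) ∧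
    ∀ (M : Matrix.GeneralLinearGroup (Fin p) (ZMod p)) (hM : PPQ.Admissible q M)
      (A : Type*) [SkewBrace A], Nat.card A = p ^ p * q → SkewBrace.IsSimple A →
      SkewBrace.Isomorphic A (PPQ.B hM) ∨ SkewBrace.Isomorphic A (PPQ.B hM)ᵃᵒᵖ := by
  have hqf : Fact q.Prime := ⟨hq⟩
  have ho := orderOf_natCast_zmod hpq
  refine ⟨exists_admissible ho, fun M hM A _ hcard hA => ?_⟩
  have hfin : Finite A := Nat.finite_of_card_ne_zero (by
    rw [hcard]
    exact mul_ne_zero (pow_ne_zero _ (Fact.out : p.Prime).ne_zero) hq.ne_zero)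
  rcases hA.exists_frame_lam_eq ho (lt_pow_self_of_dvd hpq) hcard with
    ⟨ζ, ι, x, h, hid⟩ | ⟨ζ, ι, x, h, hid⟩
  · exact Or.inl (PPQ.isomorphic_of_frame ho hM h hid)
  · have : Finite Aᵃᵒᵖ := Finite.of_equiv A AddOpposite.opEquiv
    exact Or.inr (PPQ.isomorphic_of_frame ho hM h hid).of_op
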